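/- Let $T>0$, let $\lambda\colon[0,T]\to\mathbb R$ be $C^\infty$ (up to the end points), and let $P_0\subset\mathbb R^2$ be measurable. Let $u\colon[0,T)\times\mathbb R^2\to\mathbb R$ and put $P(t)=\{x:u(t,x)>\tfrac12\}$. Suppose that $u$ solves $$u_t=\Delta u+\mu,\qquad \mu=\lambda(t)\,\mathcal H^1\lfloor_{\partial P(t)}\quad\text{in }(0,T)\times\mathbb R^2,\qquad u(0,\cdot)=\chi_{P_0},$$ where $\mathcal H^1$ is one-dimensional Hausdorff measure, in the following weak sense: $u$ is continuous on $(0,T)\times\mathbb R^2$ and integrable on $(0,T)\times B$ for every bounded ball $B$; for every bounded ball $B$ the lengths $\mathcal H^1(\partial P(t)\cap B)$, $0<t<T$, are bounded; and for every $\varphi\in C_c^\infty([0,T)\times\mathbb R^2)$ the function $t\mapsto\lambda(t)\int_{\partial P(t)}\varphi(t,x)\,d\mathcal H^1(x)$ is integrable on $(0,T)$ and $$\int_0^T\!\!\int_{\mathbb R^2}u\,(\varphi_t+\Delta\varphi)\,dx\,dt+\int_{P_0}\varphi(0,x)\,dx+\int_0^T\lambda(t)\int_{\partial P(t)}\varphi(t,x)\,d\mathcal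 H^1(x)\,dt=0 .$$ Let $p\in\partial P_0$ be a point near which the interface is a smooth graph up to time $0$: there are an orthonormal basis $(\boldsymbol\tau,\boldsymbol n)$ of $\mathbb R^2$, numbers $r>0$ and $0<\delta<T$, and a function $\gamma(t,x_1)$ that is $C^\infty$ on $[0,\delta]\times(-r,r)$, with $\gamma(0,0)=\partial_{x_1}\gamma(0,0)=0$, such that for $t\in[0,\delta]$ and $|x_1|,|x_2|<r$ the point $p+x_1\boldsymbol\tau+x_2\boldsymbol n$ lies on $\partial P(t)$ if and only if $x_2=\gamma(t,x_1)$, and, at $t=0$, lies in $P_0$ if $x_2<\gamma(0,x_1)$ and outside $P_0$ if $x_2>\gamma(0,x_1)$ (so $\boldsymbol n$ is the outer unit normal of $P_0$ at $p$). Let $\kappa=-\partial_{x_1}^2\gamma(0,0)$ be the curvature of $\partial P_0$ at $p$, positive where $P_0$ is convex. Then for all sufficiently small $t>0$ there is exactly one number $v=v(t)$ with $|t\,v(t)|<r$ and $p+t\,v(t)\,\boldsymbol n\in\partial P(t)$; it satisfies $u(t,p+t\,v(t)\,\boldsymbol n)=\tfrac12$ for all sufficiently small $t>0$; and this normal velocity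 of the $\tfrac12$-level set satisfies $$v(t)=-\kappa+2\lambda(0)+O(t),\qquad t\to0+ .$$ -/

import Mathlib

open Set Filter Topology MeasureTheory Asymptotics
open scoped ContDiff

/-- The Euclidean plane. -/
abbrev Plane : Type := EuclideanSpace ℝ (Fin 2)

/-- The phase region `P(t) = {x : u(t,x) > 1/2}`. -/
def phase (u : ℝ → Plane → ℝ) (t : ℝ) : Set Plane :=
  {x | 1 / 2 < u t x}

/-- Test functions `φ ∈ C_c^∞([0,T) × ℝ²)`: restrictions of smooth functions on `ℝ × ℝ²` with
compact support in `(-∞,T) × ℝ²`; they need not vanish at time `0`. -/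
structure IsTestFunction (T : ℝ) (φ : ℝ → Plane → ℝ) : Prop where
  smooth : ContDiff ℝ ∞ (Function.uncurry φ)
  hasCompactSupport : HasCompactSupport (Function.uncurry φ)
  tsupport_subset : tsupport (Function.uncurry φ) ⊆ Iio T ×ˢ univ

/-- `u` is a weak (distributional) solution, continuous at positive times, of the Cauchy problem
`u_t = Δ u + lam(t) ℋ¹⌊∂P(t)` in `(0,T) × ℝ²`, `u(0,·) = χ_{P₀}`, where `P(t) = {u(t,·) > 1/2}`.
The fields `locallyFinite` and `source_integrable` say that the right-hand side
`lam(t) ℋ¹⌊∂P(t) dt` is a Radon measure. -/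
structure IsWeakSolution (T : ℝ) (lam : ℝ → ℝ) (P₀ : Set Plane) (u : ℝ → Plane → ℝ) :
    Prop where
  initial : u 0 = P₀.indicator (fun _ => (1 : ℝ))
  continuousOn : ContinuousOn (Function.uncurry u) (Ioo 0 T ×ˢ univ)
  integrableOn : ∀ R : ℝ, IntegrableOn (Function.uncurry u) (Ioo 0 T ×ˢ Metric.closedBall 0 R)
  locallyFinite : ∀ R : ℝ, ∃ L : ℝ, ∀ t ∈ Ioo 0 T,
    Measure.hausdorffMeasure 1 (frontier (phase u t) ∩ Metric.closedBall 0 R) ≤ ENNReal.ofReal L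
  source_integrable : ∀ φ : ℝ → Plane → ℝ, IsTestFunction T φ →
    IntegrableOn (fun t => lam t * ∫ x in frontier (phase u t), φ t x ∂(Measure.hausdorffMeasure 1))
      (Ioo 0 T)
  weak : ∀ φ : ℝ → Plane → ℝ, IsTestFunction T φ →
    (∫ t in Ioo 0 T, ∫ x, u t x * (deriv (fun s => φ s x) t + Laplacian.laplacian (φ t) x))
      + (∫ x, u 0 x * φ 0 x)
      + (∫ t in Ioo 0 T,
          lam t * ∫ x in frontier (phase u t), φ t x ∂(Measure.hausdorffMeasure 1)) = 0

/-- The point with coordinates `(x₁, x₂)` in the orthonormal frame `e` with origin `p`. -/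
noncomputable def framePoint (p : Plane) (e : OrthonormalBasis (Fin 2) ℝ Plane) (x₁ x₂ : ℝ) :
    Plane :=
  p + x₁ • e 0 + x₂ • e 1

/-- For `0 ≤ t ≤ δ`, in the open square of half-side `r` about `p` whose sides are parallel to the
frame `e`, the boundary of `P t` is the graph of `γ t`, with `γ` smooth in `(t, x₁)` up to `t = 0`.
The graph of `γ 0` passes through `p` with tangent `e 0`, and `P 0` lies below it, so `e 1` is
the outer unit normal of `P 0` at `p`. -/
structure IsLocalGraph (P : ℝ → Set Plane) (δ r : ℝ) (p : Plane)
    (e : OrthonormalBasis (Fin 2) ℝ Plane) (γ : ℝ → ℝ → ℝ) : Prop where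
  smooth : ContDiffOn ℝ ∞ (Function.uncurry γ) (Icc 0 δ ×ˢ Ioo (-r) r)
  origin : γ 0 0 = 0
  tangent : deriv (γ 0) 0 = 0
  mem_frontier_iff : ∀ t ∈ Icc 0 δ, ∀ x₁ ∈ Ioo (-r) r, ∀ x₂ ∈ Ioo (-r) r,
    (framePoint p e x₁ x₂ ∈ frontier (P t) ↔ x₂ = γ t x₁)
  below : ∀ x₁ ∈ Ioo (-r) r, ∀ x₂ ∈ Ioo (-r) r, x₂ < γ 0 x₁ → framePoint p e x₁ x₂ ∈ P 0
  above : ∀ x₁ ∈ Ioo (-r) r, ∀ x₂ ∈ Ioo (-r) r, γ 0 x₁ < x₂ → framePoint p e x₁ x₂ ∉ P 0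

/-- Curvature at `(x, f x)` of the boundary of the subgraph `{x₂ < f x₁}`: the divergence of its
outer unit normal, positive where the subgraph is convex. -/
noncomputable def subgraphCurvature (f : ℝ → ℝ) (x : ℝ) : ℝ :=
  -(iteratedDeriv 2 f x) / (1 + (deriv f x) ^ 2) ^ ((3 : ℝ) / 2)

/-! Let `h = γ t 0` be the height of the interface over `p` at time `t`, `k` the second derivative
of `γ 0` at `0`, and `N = (4πt)^(-1/2)`. At the interface point `u = 1/2`, so Duhamel's formula
formally expresses `1/2` as the heat content of `P₀` at that point plus the heat emitted by the
curves `∂P(s)`, `0 < s < t`.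

Near `p` the set `P₀` lies below the parabola `k x₁² / 2`, whose Gaussian mean height is `k t`
because the second moment of the kernel is `2t`. The heat content is therefore `1/2 + N (k t - h)`
to leading order (`exists_abs_integral_subgraph_sub_le`). The curves are nearly flat, so integrating
the planar kernel along `∂P(s)` gives about `(4π(t-s))^(-1/2)` (`abs_source_sub_le`). Its time
integral is `√(t/π) = 2tN` (`integral_inv_sqrt`), and the source contributes `2 lam(0) t N`. The
balance forces `h / t → k + 2 lam(0)`, and `k = -κ`.

A relative error `ε`, arbitrarily small but fixed, suffices in these expansions. Since `γ` is smooth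
up to time `0`, `h = c t + O(t²)` is known beforehand; the heat balance only identifies `c`
(`IsWeakSolution.velocity_eq`), and the rate `O(t)` is that of Taylor's formula.

As `u` carries no growth bound at infinity, Duhamel's formula is replaced by testing the weak
equation with `backwardKernel`: a Gaussian with pole at time `t + β`, cut off in space, times a
cutoff `η` that drops to zero on `[t - β, t]` (`IsWeakSolution.abs_initial_add_source_sub_le`). The
term with `η'` averages `u` near the interface point and yields `1/2`. The space cutoffs act away
from the pole and cost only `O(t)`, negligible against `N t ~ √t`. Finally `β → 0` with `t` fixed.
-/

/-! ### The one-dimensional heat kernel: bounds, derivatives and moments. -/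

/-- The heat kernel on the real line. -/
noncomputable def heatKernel (τ z : ℝ) : ℝ :=
  (√(4 * Real.pi * τ))⁻¹ * Real.exp (-z ^ 2 / (4 * τ))

lemma heatKernel_nonneg (τ z : ℝ) : 0 ≤ heatKernel τ z := by
  unfold heatKernel; positivity

lemma heatKernel_neg (τ z : ℝ) : heatKernel τ (-z) = heatKernel τ z := by
  simp [heatKernel]

lemma heatKernel_le {τ : ℝ} (hτ : 0 < τ) (z : ℝ) : heatKernel τ z ≤ (√(4 * Real.pi * τ))⁻¹ := by
  unfold heatKernel
  refine mul_le_of_le_one_right (by positivity) (Real.exp_le_one_iff.2 ?_)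
  rw [neg_div]
  exact neg_nonpos.2 (by positivity)

lemma le_heatKernel {τ : ℝ} (hτ : 0 < τ) (z : ℝ) :
    (√(4 * Real.pi * τ))⁻¹ * (1 - z ^ 2 / (4 * τ)) ≤ heatKernel τ z := by
  unfold heatKernel
  refine mul_le_mul_of_nonneg_left ?_ (by positivity)
  have := Real.add_one_le_exp (-z ^ 2 / (4 * τ))
  rw [neg_div] at this ⊢
  linarith

lemma heatKernel_eq (τ : ℝ) :
    heatKernel τ = fun z => (√(4 * Real.pi * τ))⁻¹ * Real.exp (-(1 / (4 * τ)) * z ^ 2) := by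
  funext z
  unfold heatKernel
  congr 2
  ring

lemma continuous_heatKernel (τ : ℝ) : Continuous (heatKernel τ) := by
  rw [heatKernel_eq]; fun_prop

lemma integrable_heatKernel {τ : ℝ} (hτ : 0 < τ) : Integrable (heatKernel τ) := by
  rw [heatKernel_eq]
  exact (integrable_exp_neg_mul_sq (by positivity)).const_mul _

lemma integral_heatKernel {τ : ℝ} (hτ : 0 < τ) : ∫ z, heatKernel τ z = 1 := by
  rw [heatKernel_eq, integral_const_mul, integral_gaussian]
  rw [show Real.pi / (1 / (4 * τ)) = 4 * Real.pi * τ by field_simp]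
  exact inv_mul_cancel₀ (by positivity)

/-- The bound `xⁿ / n! ≤ exp x` at `x = z² / (8τ)` spends half of the Gaussian exponent on the
polynomial. What remains is the kernel at time `2τ`, again of mass one, so every even moment is
bounded at once; the factor `2` absorbs the `√2` from the normalization. -/
lemma pow_mul_heatKernel_le {τ : ℝ} (hτ : 0 < τ) (n : ℕ) (z : ℝ) :
    z ^ (2 * n) * heatKernel τ z ≤ 2 * n.factorial * (8 * τ) ^ n * heatKernel (2 * τ) z := by
  have h1 := Real.pow_div_factorial_le_exp (z ^ 2 / (8 * τ)) (by positivity) n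
  have h2 : z ^ (2 * n) ≤ n.factorial * (8 * τ) ^ n * Real.exp (z ^ 2 / (8 * τ)) := by
    rw [div_pow, div_div, div_le_iff₀ (by positivity), ← pow_mul] at h1
    linarith
  have h3 : Real.exp (z ^ 2 / (8 * τ)) * Real.exp (-z ^ 2 / (4 * τ))
      = Real.exp (-z ^ 2 / (4 * (2 * τ))) := by
    rw [← Real.exp_add]; congr 1; field_simp; ring
  have h4 : (√(4 * Real.pi * τ))⁻¹ ≤ 2 * (√(4 * Real.pi * (2 * τ)))⁻¹ := by
    have : √(4 * Real.pi * (2 * τ)) ≤ 2 * √(4 * Real.pi * τ) := by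
      rw [show 4 * Real.pi * (2 * τ) = 2 * (4 * Real.pi * τ) by ring,
        Real.sqrt_mul (by norm_num)]
      refine mul_le_mul_of_nonneg_right ?_ (by positivity)
      rw [Real.sqrt_le_left (by norm_num)]; norm_num
    rw [inv_le_iff_one_le_mul₀ (by positivity), ← div_eq_mul_inv, div_mul_eq_mul_div,
      one_le_div (by positivity)]
    exact this
  unfold heatKernel
  calc z ^ (2 * n) * ((√(4 * Real.pi * τ))⁻¹ * Real.exp (-z ^ 2 / (4 * τ)))
      ≤ (n.factorial * (8 * τ) ^ n * Real.exp (z ^ 2 / (8 * τ))) *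
        ((2 * (√(4 * Real.pi * (2 * τ)))⁻¹) * Real.exp (-z ^ 2 / (4 * τ))) := by gcongr
    _ = 2 * n.factorial * (8 * τ) ^ n * ((√(4 * Real.pi * (2 * τ)))⁻¹ *
        (Real.exp (z ^ 2 / (8 * τ)) * Real.exp (-z ^ 2 / (4 * τ)))) := by ring
    _ = _ := by rw [h3]

lemma integrable_pow_mul_heatKernel {τ : ℝ} (hτ : 0 < τ) (n : ℕ) :
    Integrable (fun z => z ^ (2 * n) * heatKernel τ z) := by
  refine ((integrable_heatKernel (τ := 2 * τ) (by positivity)).const_mul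
    (2 * n.factorial * (8 * τ) ^ n)).mono' ?_ (ae_of_all _ fun z => ?_)
  · exact ((continuous_pow _).mul (continuous_heatKernel τ)).aestronglyMeasurable
  · rw [Real.norm_of_nonneg (mul_nonneg ((even_two_mul n).pow_nonneg z) (heatKernel_nonneg _ _))]
    exact pow_mul_heatKernel_le hτ n z

lemma integral_pow_mul_heatKernel_le {τ : ℝ} (hτ : 0 < τ) (n : ℕ) :
    ∫ z, z ^ (2 * n) * heatKernel τ z ≤ 2 * n.factorial * (8 * τ) ^ n := by
  calc _ ≤ ∫ z, 2 * n.factorial * (8 * τ) ^ n * heatKernel (2 * τ) z :=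
        integral_mono (integrable_pow_mul_heatKernel hτ n)
          ((integrable_heatKernel (by positivity)).const_mul _) (pow_mul_heatKernel_le hτ n)
    _ = _ := by rw [integral_const_mul, integral_heatKernel (by positivity), mul_one]

/-- The space derivative of the heat kernel. -/
noncomputable def heatKernelDeriv (τ z : ℝ) : ℝ := -(z / (2 * τ)) * heatKernel τ z

lemma hasDerivAt_heatKernel (τ z : ℝ) :
    HasDerivAt (heatKernel τ) (heatKernelDeriv τ z) z := by
  have h : HasDerivAt (fun z : ℝ => -z ^ 2 / (4 * τ)) (-(2 * z) / (4 * τ)) z := by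
    simpa using ((hasDerivAt_pow 2 z).neg).div_const (4 * τ)
  convert! (h.exp).const_mul (√(4 * Real.pi * τ))⁻¹ using 1
  unfold heatKernelDeriv heatKernel
  rw [show -(2 * z) / (4 * τ) = -(z / (2 * τ)) by
    rw [neg_div, show 4 * τ = 2 * (2 * τ) by ring, mul_div_mul_left _ _ two_ne_zero]]
  ring

lemma hasDerivAt_heatKernelDeriv (τ z : ℝ) :
    HasDerivAt (heatKernelDeriv τ)
      ((z ^ 2 / (4 * τ ^ 2) - 1 / (2 * τ)) * heatKernel τ z) z := by
  have h : HasDerivAt (fun z : ℝ => -(z / (2 * τ))) (-(1 / (2 * τ))) z :=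
    ((hasDerivAt_id z).div_const (2 * τ)).neg
  convert! h.mul (hasDerivAt_heatKernel τ z) using 1
  unfold heatKernelDeriv
  ring

lemma hasDerivAt_heatKernel_time {τ : ℝ} (hτ : 0 < τ) (z : ℝ) :
    HasDerivAt (fun τ => heatKernel τ z)
      ((z ^ 2 / (4 * τ ^ 2) - 1 / (2 * τ)) * heatKernel τ z) τ := by
  have h0 : HasDerivAt (fun τ : ℝ => 4 * Real.pi * τ) (4 * Real.pi) τ := by
    simpa using (hasDerivAt_id τ).const_mul (4 * Real.pi)
  have h1 := (h0.sqrt (by positivity)).inv (by positivity)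
  have h2 : HasDerivAt (fun τ : ℝ => -z ^ 2 / (4 * τ)) (z ^ 2 / (4 * τ ^ 2)) τ := by
    have := ((hasDerivAt_id τ).const_mul 4).inv (by simpa using hτ.ne')
    convert! this.const_mul (-z ^ 2) using 1
    simp only [id]
    field_simp
  convert! h1.mul h2.exp using 1
  unfold heatKernel
  rw [Real.sq_sqrt (by positivity)]
  simp only [Pi.inv_apply]
  field_simp
  ring

/-- Integration by parts, as `z G' = -(z² / (2τ)) G`. Unlike the higher moments this one is needed
exactly: it produces the curvature term. -/
lemma integral_sq_mul_heatKernel {τ : ℝ} (hτ : 0 < τ) :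
    ∫ z, z ^ 2 * heatKernel τ z = 2 * τ := by
  have hi2 := integrable_pow_mul_heatKernel hτ 1
  have hi0 := integrable_heatKernel hτ
  have hi1 : Integrable (fun z => z * heatKernel τ z) := by
    refine (hi2.add hi0).mono' (continuous_id.mul (continuous_heatKernel τ)).aestronglyMeasurable
      (ae_of_all _ fun z => ?_)
    simp only [Pi.add_apply, norm_mul, Real.norm_eq_abs, abs_of_nonneg (heatKernel_nonneg τ z),
      mul_one]
    rw [← add_one_mul]
    refine mul_le_mul_of_nonneg_right ?_ (heatKernel_nonneg _ _)
    exact abs_le.2 ⟨by nlinarith [sq_nonneg (z + 1)], by nlinarith [sq_nonneg (z - 1)]⟩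
  have := integral_mul_deriv_eq_deriv_mul_of_integrable (u := fun z : ℝ => z) (u' := fun _ => 1)
    (v := heatKernel τ) (v' := heatKernelDeriv τ) (fun x _ => hasDerivAt_id x)
    (fun x _ => hasDerivAt_heatKernel τ x) ?_ ?_ hi1
  · have h2 : (fun z => z ^ 2 * heatKernel τ z)
        = fun z => -(2 * τ) * (z * heatKernelDeriv τ z) := by
      funext z; unfold heatKernelDeriv; field_simp
    rw [h2, integral_const_mul, this]
    simp [integral_heatKernel hτ]
  · convert! hi2.const_mul (-(1 / (2 * τ))) using 1
    funext z
    simp only [Pi.mul_apply, heatKernelDeriv]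
    ring
  · convert! hi0 using 1
    funext z; simp

lemma integral_heatKernel_Iio_zero {τ : ℝ} (hτ : 0 < τ) :
    ∫ z in Iio 0, heatKernel τ z = 1 / 2 := by
  have h : ∫ z in Ioi 0, heatKernel τ z = 1 / 2 := by
    rw [heatKernel_eq, integral_const_mul, integral_gaussian_Ioi,
      show Real.pi / (1 / (4 * τ)) = 4 * Real.pi * τ by field_simp]
    have : √(4 * Real.pi * τ) ≠ 0 := by positivity
    field_simp
  rw [← integral_Iic_eq_integral_Iio]
  have h2 := integral_comp_neg_Iic (0 : ℝ) (heatKernel τ)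
  simp only [heatKernel_neg, neg_zero] at h2
  rw [h2, h]

/-- The mass of the heat kernel on a half line near the origin, to first order. -/
lemma abs_integral_heatKernel_Iio_sub_le {τ : ℝ} (hτ : 0 < τ) (x : ℝ) :
    |(∫ z in Iio x, heatKernel τ z) - (1 / 2 + (√(4 * Real.pi * τ))⁻¹ * x)| ≤
      (√(4 * Real.pi * τ))⁻¹ * (|x| ^ 3 / (4 * τ)) := by
  have hi := integrable_heatKernel hτ
  have h1 : (∫ z in Iio x, heatKernel τ z) - 1 / 2 = ∫ z in (0 : ℝ)..x, heatKernel τ z := by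
    rw [← integral_heatKernel_Iio_zero hτ, ← integral_Iic_eq_integral_Iio,
      ← integral_Iic_eq_integral_Iio,
      intervalIntegral.integral_Iic_sub_Iic hi.integrableOn hi.integrableOn]
  have h2 : (∫ z in Iio x, heatKernel τ z) - (1 / 2 + (√(4 * Real.pi * τ))⁻¹ * x)
      = ∫ z in (0 : ℝ)..x, (heatKernel τ z - (√(4 * Real.pi * τ))⁻¹) := by
    rw [intervalIntegral.integral_sub hi.intervalIntegrable (by simp), ← h1]
    simp
    ring
  rw [h2]
  -- Between `0` and `x` the kernel falls short of its maximum by at most the fraction `x² / (4τ)`.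
  have h3 := intervalIntegral.norm_integral_le_of_norm_le_const (a := 0) (b := x)
    (f := fun z => heatKernel τ z - (√(4 * Real.pi * τ))⁻¹)
    (C := (√(4 * Real.pi * τ))⁻¹ * (x ^ 2 / (4 * τ))) ?_
  · rw [Real.norm_eq_abs, sub_zero] at h3
    refine h3.trans (le_of_eq ?_)
    rw [← sq_abs x]
    ring
  · intro z hz
    have hzx : z ^ 2 ≤ x ^ 2 := by
      rcases le_total 0 x with h | h
      · rw [uIoc_of_le h] at hz
        nlinarith [hz.1, hz.2]
      · rw [uIoc_of_ge h] at hz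
        nlinarith [hz.1, hz.2]
    rw [Real.norm_eq_abs, abs_sub_comm, abs_of_nonneg (sub_nonneg.2 (heatKernel_le hτ z))]
    have h4 := le_heatKernel hτ z
    have h5 : (√(4 * Real.pi * τ))⁻¹ * (z ^ 2 / (4 * τ)) ≤
      (√(4 * Real.pi * τ))⁻¹ * (x ^ 2 / (4 * τ)) := by gcongr
    linarith

/-! ### Spatial cutoffs, Gaussian averages and Gaussian mass along a graph. -/

/-- A smooth cutoff function, supported in `[-ρ, ρ]` and equal to one in `[-ρ/2, ρ/2]`. -/
structure IsCutoff (χ : ℝ → ℝ) (ρ Q : ℝ) : Prop where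
  smooth : ContDiff ℝ ∞ χ
  nonneg : ∀ z, 0 ≤ χ z
  le_one : ∀ z, χ z ≤ 1
  -- A quartic bound turns the loss caused by the cutoff into a fourth moment, of order `τ²`; no
  -- separate tail estimate is needed.
  one_sub_le : ∀ z, 1 - χ z ≤ Q * z ^ 4
  eq_zero : ∀ z, ρ ≤ |z| → χ z = 0
  eq_one : ∀ z, |z| ≤ ρ / 2 → χ z = 1

lemma IsCutoff.measurable {χ : ℝ → ℝ} {ρ Q : ℝ} (h : IsCutoff χ ρ Q) : Measurable χ :=
  h.smooth.continuous.measurable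

lemma IsCutoff.abs_le_one {χ : ℝ → ℝ} {ρ Q : ℝ} (h : IsCutoff χ ρ Q) (z : ℝ) : |χ z| ≤ 1 :=
  abs_le.2 ⟨by linarith [h.nonneg z], h.le_one z⟩

lemma integrable_heatKernel_shift {τ : ℝ} (hτ : 0 < τ) (h : ℝ) :
    Integrable (fun z => heatKernel τ (z - h)) :=
  (integrable_heatKernel hτ).comp_sub_right h

lemma integral_heatKernel_shift {τ : ℝ} (hτ : 0 < τ) (h : ℝ) :
    ∫ z, heatKernel τ (z - h) = 1 := by
  rw [integral_sub_right_eq_self (heatKernel τ), integral_heatKernel hτ]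

/-- The heat kernel is an approximate identity, for functions with quadratic modulus. -/
lemma abs_integral_mul_heatKernel_sub_le {τ : ℝ} (hτ : 0 < τ) (h : ℝ) {w : ℝ × ℝ → ℝ}
    (hw : AEStronglyMeasurable w) {w₀ c Q : ℝ}
    (hb : ∀ z, |w z - w₀| ≤ c + Q * (z.1 ^ 2 + (z.2 - h) ^ 2)) :
    |(∫ z : ℝ × ℝ, w z * (heatKernel τ z.1 * heatKernel τ (z.2 - h))) - w₀| ≤
      c + 4 * Q * τ := by
  have h0 : Integrable (fun z : ℝ × ℝ => heatKernel τ z.1 * heatKernel τ (z.2 - h)) :=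
    (integrable_heatKernel hτ).mul_prod (integrable_heatKernel_shift hτ h)
  have h2 := integrable_pow_mul_heatKernel hτ 1
  simp only [mul_one] at h2
  have h2' : Integrable (fun z => (z - h) ^ 2 * heatKernel τ (z - h)) := h2.comp_sub_right h
  have h3 : Integrable (fun z : ℝ × ℝ => (z.1 ^ 2 * heatKernel τ z.1) * heatKernel τ (z.2 - h)) :=
    h2.mul_prod (integrable_heatKernel_shift hτ h)
  have h4 : Integrable (fun z : ℝ × ℝ =>
      heatKernel τ z.1 * ((z.2 - h) ^ 2 * heatKernel τ (z.2 - h))) :=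
    (integrable_heatKernel hτ).mul_prod h2'
  have i0 : ∫ z : ℝ × ℝ, heatKernel τ z.1 * heatKernel τ (z.2 - h) = 1 := by
    rw [Measure.volume_eq_prod,
      integral_prod_mul (heatKernel τ) (fun z => heatKernel τ (z - h)), integral_heatKernel hτ,
      integral_heatKernel_shift hτ, mul_one]
  have i3 : ∫ z : ℝ × ℝ, (z.1 ^ 2 * heatKernel τ z.1) * heatKernel τ (z.2 - h) = 2 * τ := by
    rw [Measure.volume_eq_prod,
      integral_prod_mul (fun z => z ^ 2 * heatKernel τ z) (fun z => heatKernel τ (z - h)),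
      integral_sq_mul_heatKernel hτ, integral_heatKernel_shift hτ, mul_one]
  have i4 : ∫ z : ℝ × ℝ, heatKernel τ z.1 * ((z.2 - h) ^ 2 * heatKernel τ (z.2 - h)) = 2 * τ := by
    rw [Measure.volume_eq_prod,
      integral_prod_mul (heatKernel τ) (fun z => (z - h) ^ 2 * heatKernel τ (z - h)),
      integral_sub_right_eq_self (fun z => z ^ 2 * heatKernel τ z),
      integral_sq_mul_heatKernel hτ, integral_heatKernel hτ, one_mul]
  have h34 : Integrable (fun z : ℝ × ℝ =>
      Q * ((z.1 ^ 2 * heatKernel τ z.1) * heatKernel τ (z.2 - h)) +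
        Q * (heatKernel τ z.1 * ((z.2 - h) ^ 2 * heatKernel τ (z.2 - h)))) :=
    (h3.const_mul Q).add (h4.const_mul Q)
  have hB : Integrable (fun z : ℝ × ℝ => c * (heatKernel τ z.1 * heatKernel τ (z.2 - h)) +
      (Q * ((z.1 ^ 2 * heatKernel τ z.1) * heatKernel τ (z.2 - h)) +
        Q * (heatKernel τ z.1 * ((z.2 - h) ^ 2 * heatKernel τ (z.2 - h))))) :=
    (h0.const_mul c).add h34
  have hp : ∀ z : ℝ × ℝ, ‖(w z - w₀) * (heatKernel τ z.1 * heatKernel τ (z.2 - h))‖ ≤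
      c * (heatKernel τ z.1 * heatKernel τ (z.2 - h)) +
      (Q * ((z.1 ^ 2 * heatKernel τ z.1) * heatKernel τ (z.2 - h)) +
        Q * (heatKernel τ z.1 * ((z.2 - h) ^ 2 * heatKernel τ (z.2 - h)))) := by
    intro z
    have hn := mul_nonneg (heatKernel_nonneg τ z.1) (heatKernel_nonneg τ (z.2 - h))
    rw [norm_mul, Real.norm_eq_abs, Real.norm_of_nonneg hn]
    refine (mul_le_mul_of_nonneg_right (hb z) hn).trans (le_of_eq ?_)
    ring
  have hI : Integrable (fun z : ℝ × ℝ =>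
      (w z - w₀) * (heatKernel τ z.1 * heatKernel τ (z.2 - h))) :=
    hB.mono' ((hw.sub aestronglyMeasurable_const).mul h0.1) (ae_of_all _ hp)
  have he : (∫ z : ℝ × ℝ, w z * (heatKernel τ z.1 * heatKernel τ (z.2 - h))) - w₀ =
      ∫ z : ℝ × ℝ, (w z - w₀) * (heatKernel τ z.1 * heatKernel τ (z.2 - h)) := by
    have : (fun z : ℝ × ℝ => w z * (heatKernel τ z.1 * heatKernel τ (z.2 - h))) = fun z =>
        (w z - w₀) * (heatKernel τ z.1 * heatKernel τ (z.2 - h)) +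
          w₀ * (heatKernel τ z.1 * heatKernel τ (z.2 - h)) := by
      funext z; ring
    rw [this, integral_add hI (h0.const_mul w₀), integral_const_mul, i0]
    ring
  rw [he, ← Real.norm_eq_abs]
  refine (norm_integral_le_of_norm_le hB (ae_of_all _ hp)).trans (le_of_eq ?_)
  rw [integral_add (h0.const_mul c) h34,
    integral_add (h3.const_mul Q) (h4.const_mul Q)]
  simp only [integral_const_mul]
  rw [i0, i3, i4]
  ring

lemma integral_one_sub_cutoff_mul_le {χ : ℝ → ℝ} {ρ Q : ℝ} (hχ : IsCutoff χ ρ Q) (hQ : 0 ≤ Q)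
    {τ : ℝ} (hτ : 0 < τ) (h : ℝ) :
    ∫ z, (1 - χ z) * heatKernel τ (z - h) ≤ 8 * Q * (256 * τ ^ 2 + h ^ 4) := by
  have h4 := integrable_pow_mul_heatKernel hτ 2
  norm_num at h4
  have h4' : Integrable (fun z => (z - h) ^ 4 * heatKernel τ (z - h)) := h4.comp_sub_right h
  have hs := integrable_heatKernel_shift hτ h
  have m4 : ∫ z, z ^ 4 * heatKernel τ z ≤ 256 * τ ^ 2 := by
    have := integral_pow_mul_heatKernel_le hτ 2
    norm_num [Nat.factorial] at this
    linarith
  calc ∫ z, (1 - χ z) * heatKernel τ (z - h)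
      ≤ ∫ z, (8 * Q * ((z - h) ^ 4 * heatKernel τ (z - h)) +
          8 * Q * h ^ 4 * heatKernel τ (z - h)) := by
        refine integral_mono_of_nonneg (ae_of_all _ fun z => ?_)
          ((h4'.const_mul _).add (hs.const_mul _)) (ae_of_all _ fun z => ?_)
        · exact mul_nonneg (sub_nonneg.2 (hχ.le_one z)) (heatKernel_nonneg _ _)
        · simp only
          have h1 : z ^ 4 ≤ 8 * ((z - h) ^ 4 + h ^ 4) := by
            nlinarith [sq_nonneg (z ^ 2 - 2 * z * h), sq_nonneg (z - 2 * h),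
              sq_nonneg ((z - h) ^ 2 - h ^ 2), sq_nonneg ((z - h) - h), sq_nonneg (z * (z - 2 * h)),
              sq_nonneg ((z - h) ^ 2 - (z - h) * h), sq_nonneg (h ^ 2 - (z - h) * h)]
          have h2 := (hχ.one_sub_le z).trans (mul_le_mul_of_nonneg_left h1 hQ)
          refine (mul_le_mul_of_nonneg_right h2 (heatKernel_nonneg τ (z - h))).trans (le_of_eq ?_)
          ring
    _ = 8 * Q * (∫ z, z ^ 4 * heatKernel τ z) + 8 * Q * h ^ 4 := by
        rw [integral_add (h4'.const_mul _) (hs.const_mul _), integral_const_mul,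
          integral_const_mul, integral_heatKernel_shift hτ,
          integral_sub_right_eq_self (fun z => z ^ 4 * heatKernel τ z), mul_one]
    _ ≤ _ := by nlinarith

/-- Heat kernel mass along a nearly flat graph. -/
lemma integral_heatKernel_graph_mem_Icc {χ : ℝ → ℝ} {ρ Q : ℝ} (hχ : IsCutoff χ ρ Q)
    {τ : ℝ} (hτ : 0 < τ) {f : ℝ → ℝ} (hf : ContinuousOn f (Ioo (-ρ) ρ)) {h ε L : ℝ}
    (hb : ∀ z ∈ Ioo (-ρ) ρ, |f z - h| ≤ ε * |z| + L * τ) :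
    ∫ z in Ioo (-ρ) ρ, χ z * heatKernel τ z * heatKernel τ (f z - h) ∈
      Icc ((√(4 * Real.pi * τ))⁻¹ * (1 - ε ^ 2 - L ^ 2 * τ / 2 - 256 * Q * τ ^ 2))
        (√(4 * Real.pi * τ))⁻¹ := by
  -- A negative `Q` is excluded by the cutoff bounds at `z = 1`.
  by_cases hQ : 0 ≤ Q
  swap
  · have h1 := hχ.one_sub_le 1
    have h2 := hχ.le_one 1
    rw [not_le] at hQ
    nlinarith
  set N := (√(4 * Real.pi * τ))⁻¹ with hN
  have hN0 : 0 ≤ N := by positivity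
  have hm : AEStronglyMeasurable (fun z => χ z * heatKernel τ z * heatKernel τ (f z - h))
      (volume.restrict (Ioo (-ρ) ρ)) := by
    refine ContinuousOn.aestronglyMeasurable ?_ measurableSet_Ioo
    exact ((hχ.smooth.continuous.mul (continuous_heatKernel τ)).continuousOn).mul
      ((continuous_heatKernel τ).comp_continuousOn (hf.sub continuousOn_const))
  have hup : ∀ z, ‖χ z * heatKernel τ z * heatKernel τ (f z - h)‖ ≤ N * heatKernel τ z := by
    intro z
    rw [Real.norm_of_nonneg (mul_nonneg (mul_nonneg (hχ.nonneg z) (heatKernel_nonneg _ _))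
      (heatKernel_nonneg _ _)), mul_comm N]
    refine mul_le_mul ?_ (heatKernel_le hτ _) (heatKernel_nonneg _ _) (heatKernel_nonneg _ _)
    exact mul_le_of_le_one_left (heatKernel_nonneg _ _) (hχ.le_one z)
  have hg := integrable_heatKernel hτ
  have hI : IntegrableOn (fun z => χ z * heatKernel τ z * heatKernel τ (f z - h))
      (Ioo (-ρ) ρ) :=
    ((hg.const_mul N).integrableOn (s := Ioo (-ρ) ρ)).mono' hm (ae_of_all _ hup)
  constructor
  · have h2 := integrable_pow_mul_heatKernel hτ 1
    have h4 := integrable_pow_mul_heatKernel hτ 2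
    norm_num at h2 h4
    have m4 : ∫ z, z ^ 4 * heatKernel τ z ≤ 256 * τ ^ 2 := by
      have := integral_pow_mul_heatKernel_le hτ 2
      norm_num [Nat.factorial] at this
      linarith
    -- A minorant on the whole line made of even powers times the kernel, so that full moments can
    -- be inserted. It comes from `exp (-x) ≥ 1 - x`, `(a + b)² ≤ 2a² + 2b²` and `1 - χ ≤ Q z⁴`.
    have hlo : ∀ z, N * ((1 - L ^ 2 * τ / 2) * heatKernel τ z
        - ε ^ 2 / (2 * τ) * (z ^ 2 * heatKernel τ z) - Q * (z ^ 4 * heatKernel τ z)) ≤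
        (Ioo (-ρ) ρ).indicator (fun z => χ z * heatKernel τ z * heatKernel τ (f z - h)) z := by
      intro z
      have hgz := heatKernel_nonneg τ z
      have h1 := hχ.one_sub_le z
      have he : 0 ≤ (ε ^ 2 / (2 * τ) * z ^ 2) := by positivity
      have he2 : 0 ≤ L ^ 2 * τ / 2 := by positivity
      by_cases hz : z ∈ Ioo (-ρ) ρ
      · rw [indicator_of_mem hz]
        have hq : (f z - h) ^ 2 / (4 * τ) ≤ L ^ 2 * τ / 2 + ε ^ 2 / (2 * τ) * z ^ 2 := by
          have h5 : (f z - h) ^ 2 ≤ 2 * ε ^ 2 * z ^ 2 + 2 * L ^ 2 * τ ^ 2 := by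
            have h6 := hb z hz
            have h7 : (f z - h) ^ 2 ≤ (ε * |z| + L * τ) ^ 2 := by
              rw [← sq_abs]; exact pow_le_pow_left₀ (abs_nonneg _) h6 2
            have h8 : |z| ^ 2 = z ^ 2 := sq_abs z
            nlinarith [sq_nonneg (ε * |z| - L * τ)]
          rw [div_le_iff₀ (by positivity)]
          refine h5.trans (le_of_eq ?_)
          field_simp
          ring
        have h9 := le_heatKernel hτ (f z - h)
        have h10 : N * (1 - (L ^ 2 * τ / 2 + ε ^ 2 / (2 * τ) * z ^ 2)) ≤
            heatKernel τ (f z - h) := by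
          refine le_trans ?_ h9
          gcongr
        have hχ0 := hχ.nonneg z
        have hχ1 := hχ.le_one z
        calc N * ((1 - L ^ 2 * τ / 2) * heatKernel τ z
              - ε ^ 2 / (2 * τ) * (z ^ 2 * heatKernel τ z) - Q * (z ^ 4 * heatKernel τ z))
            = heatKernel τ z * (N * ((1 - Q * z ^ 4) -
                (L ^ 2 * τ / 2 + ε ^ 2 / (2 * τ) * z ^ 2))) := by ring
          _ ≤ heatKernel τ z * (N * (χ z * (1 - (L ^ 2 * τ / 2 + ε ^ 2 / (2 * τ) * z ^ 2)))) := by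
              gcongr
              nlinarith
          _ = χ z * heatKernel τ z *
              (N * (1 - (L ^ 2 * τ / 2 + ε ^ 2 / (2 * τ) * z ^ 2))) := by ring
          _ ≤ _ := by gcongr
      · rw [indicator_of_notMem hz]
        have hz' : ρ ≤ |z| := by
          by_contra hc
          exact hz (abs_lt.1 (not_le.1 hc))
        -- Where `χ` vanishes, `1 ≤ Q z⁴`, so the minorant is nonpositive there.
        rw [hχ.eq_zero z hz'] at h1
        have : N * ((1 - L ^ 2 * τ / 2) * heatKernel τ z
              - ε ^ 2 / (2 * τ) * (z ^ 2 * heatKernel τ z) - Q * (z ^ 4 * heatKernel τ z))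
            = (N * heatKernel τ z) * ((1 - Q * z ^ 4) -
                (L ^ 2 * τ / 2 + ε ^ 2 / (2 * τ) * z ^ 2)) := by ring
        rw [this]
        exact mul_nonpos_of_nonneg_of_nonpos (mul_nonneg hN0 hgz) (by linarith)
    rw [← integral_indicator measurableSet_Ioo]
    have h02 : Integrable (fun z => (1 - L ^ 2 * τ / 2) * heatKernel τ z
        - ε ^ 2 / (2 * τ) * (z ^ 2 * heatKernel τ z)) := (hg.const_mul _).sub (h2.const_mul _)
    have hloI := (h02.sub (h4.const_mul Q)).const_mul N
    refine le_trans ?_ (integral_mono hloI (hI.integrable_indicator measurableSet_Ioo) hlo)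
    simp only [Pi.sub_apply]
    rw [integral_const_mul, integral_sub h02 (h4.const_mul _),
      integral_sub (hg.const_mul _) (h2.const_mul _)]
    simp only [integral_const_mul]
    rw [integral_heatKernel hτ, integral_sq_mul_heatKernel hτ]
    refine mul_le_mul_of_nonneg_left ?_ hN0
    rw [show ε ^ 2 / (2 * τ) * (2 * τ) = ε ^ 2 by field_simp]
    nlinarith
  · calc ∫ z in Ioo (-ρ) ρ, χ z * heatKernel τ z * heatKernel τ (f z - h)
        ≤ ∫ z in Ioo (-ρ) ρ, N * heatKernel τ z :=
          integral_mono hI (hg.const_mul N).integrableOn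
            fun z => (le_abs_self _).trans (hup z)
      _ ≤ ∫ z, N * heatKernel τ z :=
          setIntegral_le_integral (hg.const_mul N)
            (ae_of_all _ fun z => mul_nonneg hN0 (heatKernel_nonneg _ _))
      _ = N := by rw [integral_const_mul, integral_heatKernel hτ, mul_one]

/-! ### Heat content of a subgraph. -/

lemma integral_Iio_heatKernel_shift (τ h w : ℝ) :
    ∫ x, (Iio w).indicator (fun x => heatKernel τ (x - h)) x =
      ∫ x in Iio (w - h), heatKernel τ x := by
  rw [← integral_indicator measurableSet_Iio,
    ← integral_sub_right_eq_self ((Iio (w - h)).indicator (heatKernel τ)) h]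
  congr 1
  funext x
  simp only [indicator, mem_Iio, sub_lt_sub_iff_right]

lemma IsCutoff.integrable_mul_heatKernel {χ : ℝ → ℝ} {ρ Q : ℝ} (hχ : IsCutoff χ ρ Q)
    {τ : ℝ} (hτ : 0 < τ) (h : ℝ) : Integrable (fun x => χ x * heatKernel τ (x - h)) :=
  (integrable_heatKernel_shift hτ h).bdd_mul (c := 1) hχ.measurable.aestronglyMeasurable
    (ae_of_all _ fun x => by simpa using hχ.abs_le_one x)

/-- This is the heat content of one vertical line. Up to the null set `{w}`, `S` is the half line
wherever `|x| < ρ`, so replacing the cut-off integral by the full half-line one costs at most the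
mass of `1 - χ`; beyond `ρ`, where `S` is unknown, `1 - χ = 1` pays for everything. -/
lemma abs_integral_halfLine_sub_le {χ : ℝ → ℝ} {ρ Q : ℝ} (hχ : IsCutoff χ ρ Q)
    {τ : ℝ} (hτ : 0 < τ) (h w : ℝ) {S : Set ℝ} (hS : MeasurableSet S)
    (hlo : ∀ x, |x| < ρ → x < w → x ∈ S) (hhi : ∀ x, |x| < ρ → w < x → x ∉ S) :
    |(∫ x, S.indicator (fun x => χ x * heatKernel τ (x - h)) x) -
      (1 / 2 + (√(4 * Real.pi * τ))⁻¹ * (w - h))| ≤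
      (√(4 * Real.pi * τ))⁻¹ * (|w - h| ^ 3 / (4 * τ)) +
        ∫ x, (1 - χ x) * heatKernel τ (x - h) := by
  have hg := integrable_heatKernel_shift hτ h
  have hc := hχ.integrable_mul_heatKernel hτ h
  have hd : Integrable (fun x => (1 - χ x) * heatKernel τ (x - h)) := by
    convert! hg.sub hc using 1
    funext x
    simp only [Pi.sub_apply]
    ring
  have h1 : |(∫ x, S.indicator (fun x => χ x * heatKernel τ (x - h)) x) -
      ∫ x, (Iio w).indicator (fun x => heatKernel τ (x - h)) x| ≤
      ∫ x, (1 - χ x) * heatKernel τ (x - h) := by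
    rw [← integral_sub (hc.indicator hS) (hg.indicator measurableSet_Iio), ← Real.norm_eq_abs]
    refine norm_integral_le_of_norm_le hd ?_
    have hne : ∀ᵐ x : ℝ, x ≠ w := by simp [ae_iff]
    filter_upwards [hne] with x hx
    have hgx := heatKernel_nonneg τ (x - h)
    have hx1 := hχ.le_one x
    have key : 0 ≤ (1 - χ x) * heatKernel τ (x - h) := mul_nonneg (by linarith) hgx
    rcases lt_or_ge |x| ρ with hr | hr
    · rcases lt_or_gt_of_ne hx with hlt | hgt
      · rw [indicator_of_mem (hlo x hr hlt), indicator_of_mem (mem_Iio.2 hlt), ← sub_one_mul,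
          Real.norm_eq_abs, abs_mul, abs_of_nonneg hgx, abs_sub_comm, abs_of_nonneg (by linarith)]
      · rw [indicator_of_notMem (hhi x hr hgt), indicator_of_notMem (by simpa using hgt.le)]
        simpa using key
    · have h0 := hχ.eq_zero x hr
      rw [h0] at key ⊢
      simp only [indicator, h0, zero_mul, ite_self, zero_sub, norm_neg, sub_zero, one_mul]
      split_ifs
      · rw [Real.norm_of_nonneg hgx]
      · simpa using hgx
  have h2 := abs_integral_heatKernel_Iio_sub_le hτ (w - h)
  rw [integral_Iio_heatKernel_shift] at h1
  have h3 := abs_sub_le (∫ x, S.indicator (fun x => χ x * heatKernel τ (x - h)) x)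
    (∫ x in Iio (w - h), heatKernel τ x) (1 / 2 + (√(4 * Real.pi * τ))⁻¹ * (w - h))
  linarith

lemma add_pow_three_le {x y : ℝ} (hx : 0 ≤ x) (hy : 0 ≤ y) :
    (x + y) ^ 3 ≤ 4 * (x ^ 3 + y ^ 3) := by
  nlinarith [mul_nonneg (add_nonneg hx hy) (sq_nonneg (x - y))]

/-- The heat content of vertical lines below a `C²` graph, with its errors as even powers. -/
lemma abs_cutoff_mul_sub_le {χ : ℝ → ℝ} {ρ Q : ℝ} (hχ : IsCutoff χ ρ Q) {ψ : ℝ → ℝ}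
    {k ε : ℝ} (hε1 : ε ≤ 1) (hψ : ∀ z, |z| < ρ → |ψ z - k / 2 * z ^ 2| ≤ ε * z ^ 2)
    {τ N h κ : ℝ} (hτ : 0 < τ) (hN : 0 ≤ N) (hκ : 0 ≤ κ) {H : ℝ → ℝ}
    (hH : ∀ z, |z| < ρ → |H z - (1 / 2 + N * (ψ z - h))| ≤ N * (|ψ z - h| ^ 3 / (4 * τ)) + κ)
    (z : ℝ) :
    |χ z * H z - (1 / 2 + N * (k / 2 * z ^ 2 - h))| ≤
      (N * |h| ^ 3 / τ + κ) + N * ε * z ^ 2 + Q * (1 / 2 + N * |h|) * z ^ 4 +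
        (N * (|k| + 1) ^ 3 / τ + Q * N * |k|) * z ^ 6 := by
  have hχ0 := hχ.nonneg z
  have hχ1 := hχ.le_one z
  have hq := hχ.one_sub_le z
  have hz2 : 0 ≤ z ^ 2 := sq_nonneg z
  -- With `m` the expected value, `χ H - m = χ (H - m) - (1 - χ) m`. This bounds the second term,
  -- `hnear` the first.
  have hfar : (1 - χ z) * |1 / 2 + N * (k / 2 * z ^ 2 - h)| ≤
      Q * (1 / 2 + N * |h|) * z ^ 4 + Q * N * |k| * z ^ 6 := by
    have h1 : |1 / 2 + N * (k / 2 * z ^ 2 - h)| ≤ (1 / 2 + N * |h|) + N * |k| * z ^ 2 := by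
      have ha := abs_add_le (1 / 2) (N * (k / 2 * z ^ 2 - h))
      have hb := abs_sub (k / 2 * z ^ 2) h
      rw [abs_mul, abs_of_nonneg hN, abs_of_pos (by norm_num : (0 : ℝ) < 1 / 2)] at ha
      rw [abs_mul, abs_of_nonneg hz2, abs_div, abs_of_pos (by norm_num : (0 : ℝ) < 2)] at hb
      have hkz : 0 ≤ |k| * z ^ 2 := by positivity
      have : |k / 2 * z ^ 2 - h| ≤ |k| * z ^ 2 + |h| := by linarith
      nlinarith [mul_le_mul_of_nonneg_left this hN]
    have hA : 0 ≤ (1 / 2 + N * |h|) + N * |k| * z ^ 2 := by positivity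
    calc _ ≤ (1 - χ z) * ((1 / 2 + N * |h|) + N * |k| * z ^ 2) :=
          mul_le_mul_of_nonneg_left h1 (by linarith)
      _ ≤ (Q * z ^ 4) * ((1 / 2 + N * |h|) + N * |k| * z ^ 2) :=
          mul_le_mul_of_nonneg_right hq hA
      _ = _ := by ring
  have hnear : χ z * |H z - (1 / 2 + N * (k / 2 * z ^ 2 - h))| ≤
      (N * |h| ^ 3 / τ + κ) + N * ε * z ^ 2 + N * (|k| + 1) ^ 3 / τ * z ^ 6 := by
    rcases lt_or_ge |z| ρ with hr | hr
    · have hp := hψ z hr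
      have hε0 : 0 ≤ ε * z ^ 2 := (abs_nonneg _).trans hp
      have hR : 0 ≤ (N * |h| ^ 3 / τ + κ) + N * ε * z ^ 2 + N * (|k| + 1) ^ 3 / τ * z ^ 6 := by
        have : 0 ≤ N * ε * z ^ 2 := by rw [mul_assoc]; exact mul_nonneg hN hε0
        positivity
      refine (mul_le_of_le_one_left (abs_nonneg _) hχ1).trans ?_
      have h1 : |ψ z| ≤ (|k| + 1) * z ^ 2 := by
        have h2 : |k / 2 * z ^ 2| ≤ |k| * z ^ 2 := by
          rw [abs_mul, abs_of_nonneg hz2, abs_div, abs_of_pos (by norm_num : (0 : ℝ) < 2)]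
          nlinarith [abs_nonneg k]
        have h3 := abs_sub_abs_le_abs_sub (ψ z) (k / 2 * z ^ 2)
        nlinarith
      have h2 : |ψ z - h| ^ 3 ≤ 4 * ((|k| + 1) ^ 3 * z ^ 6 + |h| ^ 3) := by
        calc |ψ z - h| ^ 3 ≤ ((|k| + 1) * z ^ 2 + |h|) ^ 3 :=
              pow_le_pow_left₀ (abs_nonneg _) ((abs_sub _ _).trans (by linarith)) 3
          _ ≤ 4 * (((|k| + 1) * z ^ 2) ^ 3 + |h| ^ 3) :=
              add_pow_three_le (by positivity) (abs_nonneg _)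
          _ = _ := by ring
      have h3 : N * (|ψ z - h| ^ 3 / (4 * τ)) ≤
          N * |h| ^ 3 / τ + N * (|k| + 1) ^ 3 / τ * z ^ 6 := by
        calc N * (|ψ z - h| ^ 3 / (4 * τ)) ≤
              N * (4 * ((|k| + 1) ^ 3 * z ^ 6 + |h| ^ 3) / (4 * τ)) := by gcongr
          _ = _ := by field_simp; ring
      have h4 : |N * (ψ z - h) - N * (k / 2 * z ^ 2 - h)| ≤ N * ε * z ^ 2 := by
        rw [← mul_sub, abs_mul, abs_of_nonneg hN, sub_sub_sub_cancel_right, mul_assoc]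
        exact mul_le_mul_of_nonneg_left hp hN
      have h5 := abs_sub_le (H z) (1 / 2 + N * (ψ z - h)) (1 / 2 + N * (k / 2 * z ^ 2 - h))
      rw [add_sub_add_left_eq_sub] at h5
      have h6 := hH z hr
      linarith
    · rw [hχ.eq_zero z hr, zero_mul]
      -- A nonpositive `ρ` would give `χ 0 = 0`, against `1 - χ 0 ≤ 0`. With `ρ > 0`, `hψ` at `ρ /
      -- 2` forces `0 ≤ ε`.
      by_cases hρ : |(0 : ℝ)| < ρ
      swap
      · have h0 := hχ.one_sub_le 0
        rw [hχ.eq_zero 0 (not_lt.1 hρ)] at h0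
        norm_num at h0
      have : 0 ≤ ε := by
        have hp := hψ (ρ / 2) (by rw [abs_zero] at hρ; rw [abs_of_pos (by linarith)]; linarith)
        have := (abs_nonneg _).trans hp
        rw [abs_zero] at hρ
        exact nonneg_of_mul_nonneg_left this (by positivity)
      positivity
  have hsplit : χ z * H z - (1 / 2 + N * (k / 2 * z ^ 2 - h)) =
      χ z * (H z - (1 / 2 + N * (k / 2 * z ^ 2 - h))) -
        (1 - χ z) * (1 / 2 + N * (k / 2 * z ^ 2 - h)) := by ring
  rw [hsplit]
  refine (abs_sub _ _).trans ?_
  rw [abs_mul, abs_mul, abs_of_nonneg hχ0, abs_of_nonneg (sub_nonneg.2 hχ1)]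
  linarith

/-- Heat content of a subgraph: the heat kernel mass below a `C²` graph, to first order. -/
lemma exists_abs_integral_subgraph_sub_le {χ : ℝ → ℝ} {ρ Q : ℝ} (hχ : IsCutoff χ ρ Q)
    (hQ : 0 ≤ Q) {ψ : ℝ → ℝ} {k ε K : ℝ} (hK : 0 ≤ K) (hε1 : ε ≤ 1)
    (hψ : ∀ z, |z| < ρ → |ψ z - k / 2 * z ^ 2| ≤ ε * z ^ 2)
    {S : Set (ℝ × ℝ)} (hS : MeasurableSet S)
    (hlo : ∀ x y, |x| < ρ → |y| < ρ → y < ψ x → (x, y) ∈ S)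
    (hhi : ∀ x y, |x| < ρ → |y| < ρ → ψ x < y → (x, y) ∉ S) :
    ∃ C, ∀ τ h : ℝ, 0 < τ → τ ≤ 1 → |h| ≤ K * τ →
      |(∫ z : ℝ × ℝ, S.indicator (fun z => χ z.1 * heatKernel τ z.1 *
          (χ z.2 * heatKernel τ (z.2 - h))) z) -
        (1 / 2 + (√(4 * Real.pi * τ))⁻¹ * (k * τ - h))| ≤
      (√(4 * Real.pi * τ))⁻¹ * (2 * ε * τ + C * τ ^ 2) := by
  -- The first two summands bound the constant part of the pointwise error, with `|h| ≤ K τ`. The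
  -- others come from its `z⁴` and `z⁶` parts: `256` and `6144` are `2 · n! · 8ⁿ` for `n = 2, 3`.
  refine ⟨K ^ 3 + 32 * Q * (256 + K ^ 4) + 256 * Q * (2 + K) + 6144 * (|k| + 1) ^ 3
    + 6144 * Q * |k|, fun τ h hτ hτ1 hh => ?_⟩
  set N := (√(4 * Real.pi * τ))⁻¹ with hNdef
  have hN : 0 ≤ N := by positivity
  have hg := integrable_heatKernel hτ
  have hc := hχ.integrable_mul_heatKernel hτ h
  have hc0 := hχ.integrable_mul_heatKernel hτ 0
  simp only [sub_zero] at hc0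
  have hF : Integrable (fun z : ℝ × ℝ => χ z.1 * heatKernel τ z.1 *
      (χ z.2 * heatKernel τ (z.2 - h))) := hc0.mul_prod hc
  have hFS := hF.indicator hS
  set H : ℝ → ℝ := fun x =>
    ∫ y, (Prod.mk x ⁻¹' S).indicator (fun y => χ y * heatKernel τ (y - h)) y with hHdef
  have hfub : (∫ z : ℝ × ℝ, S.indicator (fun z => χ z.1 * heatKernel τ z.1 *
          (χ z.2 * heatKernel τ (z.2 - h))) z) = ∫ x, χ x * H x * heatKernel τ x := by
    rw [Measure.volume_eq_prod, integral_prod _ hFS]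
    congr 1
    funext x
    rw [mul_right_comm, ← integral_const_mul]
    congr 1
    funext y
    by_cases hxy : (x, y) ∈ S
    · rw [indicator_of_mem hxy, indicator_of_mem (by exact hxy)]
    · rw [indicator_of_notMem hxy, indicator_of_notMem (by exact hxy), mul_zero]
  have hHint : Integrable (fun x => χ x * H x * heatKernel τ x) := by
    have := hFS.integral_prod_left
    convert! this using 1
    funext x
    rw [mul_right_comm, ← integral_const_mul]
    congr 1
    funext y
    by_cases hxy : (x, y) ∈ S
    · rw [indicator_of_mem hxy, indicator_of_mem (by exact hxy)]
    · rw [indicator_of_notMem hxy, indicator_of_notMem (by exact hxy), mul_zero]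
  set κ := ∫ x, (1 - χ x) * heatKernel τ (x - h) with hκdef
  have hκ0 : 0 ≤ κ := integral_nonneg fun x =>
    mul_nonneg (sub_nonneg.2 (hχ.le_one x)) (heatKernel_nonneg _ _)
  have hκ := integral_one_sub_cutoff_mul_le hχ hQ hτ h
  rw [← hκdef] at hκ
  have hHb : ∀ z, |z| < ρ →
      |H z - (1 / 2 + N * (ψ z - h))| ≤ N * (|ψ z - h| ^ 3 / (4 * τ)) + κ := by
    intro z hz
    exact abs_integral_halfLine_sub_le hχ hτ h (ψ z) (measurable_prodMk_left hS)
      (fun x hx hlt => hlo z x hz hx hlt) (fun x hx hlt => hhi z x hz hx hlt)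
  have hpt := abs_cutoff_mul_sub_le hχ hε1 hψ hτ hN hκ0 hHb
  have h2 := integrable_pow_mul_heatKernel hτ 1
  have h4 := integrable_pow_mul_heatKernel hτ 2
  have h6 := integrable_pow_mul_heatKernel hτ 3
  have m4 := integral_pow_mul_heatKernel_le hτ 2
  have m6 := integral_pow_mul_heatKernel_le hτ 3
  norm_num [Nat.factorial] at h2 h4 h6 m4 m6
  have m2 := integral_sq_mul_heatKernel hτ
  have hmain : ∫ x, (1 / 2 + N * (k / 2 * x ^ 2 - h)) * heatKernel τ x
      = 1 / 2 + N * (k * τ - h) := by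
    have : (fun x => (1 / 2 + N * (k / 2 * x ^ 2 - h)) * heatKernel τ x) = fun x =>
        (1 / 2 - N * h) * heatKernel τ x + N * (k / 2) * (x ^ 2 * heatKernel τ x) := by
      funext x; ring
    rw [this, integral_add (hg.const_mul _) (h2.const_mul _), integral_const_mul,
      integral_const_mul, m2, integral_heatKernel hτ]
    ring
  have hmainI : Integrable (fun x => (1 / 2 + N * (k / 2 * x ^ 2 - h)) * heatKernel τ x) := by
    convert! (hg.const_mul (1 / 2 - N * h)).add (h2.const_mul (N * (k / 2))) using 1
    funext x
    simp only [Pi.add_apply]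
    ring
  set c0 := N * |h| ^ 3 / τ + κ with hc0def
  set c4 := Q * (1 / 2 + N * |h|) with hc4def
  set c6 := N * (|k| + 1) ^ 3 / τ + Q * N * |k| with hc6def
  have hb1 : Integrable (fun x => c0 * heatKernel τ x + N * ε * (x ^ 2 * heatKernel τ x)) :=
    (hg.const_mul _).add (h2.const_mul _)
  have hb2 : Integrable (fun x => c0 * heatKernel τ x + N * ε * (x ^ 2 * heatKernel τ x) +
      c4 * (x ^ 4 * heatKernel τ x)) := hb1.add (h4.const_mul _)
  have hb3 : Integrable (fun x => c0 * heatKernel τ x + N * ε * (x ^ 2 * heatKernel τ x) +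
      c4 * (x ^ 4 * heatKernel τ x) + c6 * (x ^ 6 * heatKernel τ x)) := hb2.add (h6.const_mul _)
  rw [hfub, ← hmain, ← integral_sub hHint hmainI, ← Real.norm_eq_abs]
  have hle := norm_integral_le_of_norm_le hb3 (ae_of_all _ fun x => by
    rw [← sub_mul, norm_mul, Real.norm_of_nonneg (heatKernel_nonneg τ x), Real.norm_eq_abs]
    refine (mul_le_mul_of_nonneg_right (hpt x) (heatKernel_nonneg τ x)).trans (le_of_eq ?_)
    ring : ∀ᵐ x, ‖χ x * H x * heatKernel τ x -
      (1 / 2 + N * (k / 2 * x ^ 2 - h)) * heatKernel τ x‖ ≤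
      c0 * heatKernel τ x + N * ε * (x ^ 2 * heatKernel τ x) +
      c4 * (x ^ 4 * heatKernel τ x) + c6 * (x ^ 6 * heatKernel τ x))
  refine hle.trans ?_
  rw [integral_add hb2 (h6.const_mul _), integral_add hb1 (h4.const_mul _),
    integral_add (hg.const_mul _) (h2.const_mul _)]
  simp only [integral_const_mul]
  rw [m2, integral_heatKernel hτ]
  -- For `τ ≤ 1` this lets errors without a factor `N` be charged to `N`.
  have hN4 : 1 ≤ 4 * N := by
    have h1 : √(4 * Real.pi * τ) ≤ 4 := by
      rw [Real.sqrt_le_left (by norm_num)]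
      nlinarith [Real.pi_pos, Real.pi_lt_four]
    have h2 : (0 : ℝ) < √(4 * Real.pi * τ) := by positivity
    rw [hNdef, ← div_eq_mul_inv, one_le_div h2]
    exact h1
  have hτ2 : τ ^ 2 ≤ 1 := by nlinarith
  have hc4p : 0 ≤ c4 := by positivity
  have hc6p : 0 ≤ c6 := by positivity
  have e4 : c4 * (∫ x, x ^ 4 * heatKernel τ x) ≤ N * (256 * Q * (2 + K)) * τ ^ 2 := by
    have e1 : c4 ≤ N * (Q * (2 + K)) := by
      have e2 : |h| ≤ K := hh.trans (mul_le_of_le_one_right hK hτ1)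
      have e3 : 1 / 2 + N * |h| ≤ N * (2 + K) := by
        nlinarith [mul_le_mul_of_nonneg_left e2 hN]
      calc c4 ≤ Q * (N * (2 + K)) := mul_le_mul_of_nonneg_left e3 hQ
        _ = _ := by ring
    calc c4 * (∫ x, x ^ 4 * heatKernel τ x) ≤ c4 * (256 * τ ^ 2) := by
          refine mul_le_mul_of_nonneg_left ?_ hc4p
          linarith
      _ ≤ N * (Q * (2 + K)) * (256 * τ ^ 2) := by gcongr
      _ = _ := by ring
  have e6 : c6 * (∫ x, x ^ 6 * heatKernel τ x) ≤
      N * (6144 * (|k| + 1) ^ 3 + 6144 * Q * |k|) * τ ^ 2 := by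
    calc c6 * (∫ x, x ^ 6 * heatKernel τ x) ≤ c6 * (6144 * τ ^ 3) := by
          refine mul_le_mul_of_nonneg_left ?_ hc6p
          linarith
      _ = N * (6144 * (|k| + 1) ^ 3 + 6144 * Q * |k| * τ) * τ ^ 2 := by
          rw [hc6def]; field_simp
      _ ≤ N * (6144 * (|k| + 1) ^ 3 + 6144 * Q * |k| * 1) * τ ^ 2 := by gcongr
      _ = _ := by ring
  have e0 : c0 ≤ N * (K ^ 3 + 32 * Q * (256 + K ^ 4)) * τ ^ 2 := by
    have f1 : N * |h| ^ 3 / τ ≤ N * K ^ 3 * τ ^ 2 := by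
      calc N * |h| ^ 3 / τ ≤ N * (K * τ) ^ 3 / τ := by gcongr
        _ = _ := by field_simp
    have f2 : h ^ 4 ≤ K ^ 4 * τ ^ 2 := by
      calc h ^ 4 = |h| ^ 4 := by rw [← abs_pow, abs_of_nonneg (by positivity)]
        _ ≤ (K * τ) ^ 4 := by gcongr
        _ = K ^ 4 * τ ^ 2 * τ ^ 2 := by ring
        _ ≤ K ^ 4 * τ ^ 2 * 1 := by gcongr
        _ = _ := by ring
    have f3 : κ ≤ 8 * Q * (256 + K ^ 4) * τ ^ 2 := by
      refine hκ.trans ?_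
      calc 8 * Q * (256 * τ ^ 2 + h ^ 4) ≤ 8 * Q * (256 * τ ^ 2 + K ^ 4 * τ ^ 2) := by gcongr
        _ = _ := by ring
    have f4 : 8 * Q * (256 + K ^ 4) * τ ^ 2 ≤ N * (32 * Q * (256 + K ^ 4)) * τ ^ 2 := by
      have : 0 ≤ 8 * Q * (256 + K ^ 4) * τ ^ 2 := by positivity
      nlinarith
    rw [hc0def]
    linarith
  linarith

/-! ### Existence of space and time cutoffs. -/

lemma exists_isCutoff {ρ : ℝ} (hρ : 0 < ρ) : ∃ χ, IsCutoff χ ρ (16 / ρ ^ 4) := by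
  let f : ContDiffBump (0 : ℝ) := ⟨ρ / 2, ρ, by positivity, by linarith⟩
  have h1 : ∀ z : ℝ, |z| ≤ ρ / 2 → f z = 1 := fun z hz =>
    f.one_of_mem_closedBall (by simpa [f] using hz)
  refine ⟨f, f.contDiff, fun z => f.nonneg, fun z => f.le_one, fun z => ?_, fun z hz => ?_, h1⟩
  · rcases le_or_gt |z| (ρ / 2) with h | h
    · rw [h1 z h, sub_self]; positivity
    · have h2 : (ρ / 2) ^ 4 ≤ z ^ 4 := by
        calc (ρ / 2) ^ 4 ≤ |z| ^ 4 := by gcongr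
          _ = z ^ 4 := by rw [← abs_pow, abs_of_nonneg (by positivity)]
      have h3 : 1 ≤ 16 / ρ ^ 4 * z ^ 4 := by
        rw [div_mul_eq_mul_div, one_le_div (by positivity)]
        nlinarith
      linarith [f.nonneg (x := z)]
  · exact f.zero_of_le_dist (by simpa [f] using hz)

/-- A smooth cutoff in time which drops from one to zero between `t - β` and `t`. -/
structure IsTimeCutoff (η : ℝ → ℝ) (t β M : ℝ) : Prop where
  smooth : ContDiff ℝ ∞ η
  nonneg : ∀ s, 0 ≤ η s
  le_one : ∀ s, η s ≤ 1
  eq_one : ∀ s, 0 ≤ s → s ≤ t - β → η s = 1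
  eq_zero : ∀ s, t ≤ s → η s = 0
  eq_zero' : ∀ s, s ≤ -2 → η s = 0
  deriv_eq_zero : ∀ s, 0 < s → s < t - β → deriv η s = 0
  abs_deriv_le : ∀ s, 0 < s → |deriv η s| ≤ M / β

/-- The point is that `M`, a bound for the derivative of `Real.smoothTransition`, depends on neither
`t` nor `β`. -/
lemma exists_isTimeCutoff :
    ∃ M, 0 ≤ M ∧ ∀ t β : ℝ, 0 < β → β < t → ∃ η, IsTimeCutoff η t β M := by
  have hd : Continuous (deriv Real.smoothTransition) :=
    (Real.smoothTransition.contDiff (n := 1)).continuous_deriv le_rfl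
  obtain ⟨M, hM⟩ := (isCompact_Icc (a := (0 : ℝ)) (b := 1)).exists_bound_of_continuousOn
    hd.continuousOn
  have hM0 : 0 ≤ M := (norm_nonneg _).trans (hM 0 (by simp))
  have hMall : ∀ x, |deriv Real.smoothTransition x| ≤ M := by
    intro x
    by_cases hx : x ∈ Icc (0 : ℝ) 1
    · exact hM x hx
    · have : deriv Real.smoothTransition x = 0 := by
        rcases lt_or_ge x 0 with h | h
        · have : Real.smoothTransition =ᶠ[𝓝 x] fun _ => 0 := by
            filter_upwards [Iio_mem_nhds h] with y hy
            exact Real.smoothTransition.zero_of_nonpos (le_of_lt hy)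
          rw [this.deriv_eq, deriv_const]
        · have h1 : 1 < x := by
            by_contra hc
            exact hx ⟨h, not_lt.1 hc⟩
          have : Real.smoothTransition =ᶠ[𝓝 x] fun _ => 1 := by
            filter_upwards [Ioi_mem_nhds h1] with y hy
            exact Real.smoothTransition.one_of_one_le (le_of_lt hy)
          rw [this.deriv_eq, deriv_const]
      rw [this, abs_zero]
      exact hM0
  -- The second factor only makes the support bounded in the past; it equals one for `s ≥ -1`.
  refine ⟨M, hM0, fun t β hβ hβt => ⟨fun s => Real.smoothTransition ((t - s) / β) *
    Real.smoothTransition (s + 2), ?_⟩⟩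
  have hloc : ∀ s : ℝ, 0 < s → (fun s => Real.smoothTransition ((t - s) / β) *
      Real.smoothTransition (s + 2)) =ᶠ[𝓝 s] fun s => Real.smoothTransition ((t - s) / β) := by
    intro s hs
    filter_upwards [Ioi_mem_nhds hs] with r hr
    rw [Real.smoothTransition.one_of_one_le (x := r + 2) (by linarith [mem_Ioi.1 hr]), mul_one]
  have h1 : ∀ s : ℝ, s ≤ t - β → Real.smoothTransition ((t - s) / β) = 1 := fun s hs =>
    Real.smoothTransition.one_of_one_le ((one_le_div hβ).2 (by linarith))
  refine ⟨?_, fun s => ?_, fun s => ?_, fun s hs hs' => ?_, fun s hs => ?_, fun s hs => ?_,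
    fun s hs hs' => ?_, fun s hs => ?_⟩
  · exact (Real.smoothTransition.contDiff.comp (by fun_prop)).mul
      (Real.smoothTransition.contDiff.comp (by fun_prop))
  · exact mul_nonneg (Real.smoothTransition.nonneg _) (Real.smoothTransition.nonneg _)
  · exact mul_le_one₀ (Real.smoothTransition.le_one _) (Real.smoothTransition.nonneg _)
      (Real.smoothTransition.le_one _)
  · rw [h1 s hs', Real.smoothTransition.one_of_one_le (x := s + 2) (by linarith), mul_one]
  · rw [Real.smoothTransition.zero_of_nonpos
      (div_nonpos_of_nonpos_of_nonneg (by linarith) hβ.le), zero_mul]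
  · rw [Real.smoothTransition.zero_of_nonpos (x := s + 2) (by linarith), mul_zero]
  · rw [(hloc s hs).deriv_eq]
    have : (fun s => Real.smoothTransition ((t - s) / β)) =ᶠ[𝓝 s] fun _ => 1 := by
      filter_upwards [Iio_mem_nhds hs'] with r hr
      exact h1 r (le_of_lt hr)
    rw [this.deriv_eq, deriv_const]
  · rw [(hloc s hs).deriv_eq]
    have h2 : HasDerivAt (fun s => (t - s) / β) (-1 / β) s :=
      ((hasDerivAt_id s).const_sub t).div_const β
    have h3 := ((Real.smoothTransition.contDiff (n := 1)).differentiable (by simp)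
      ((t - s) / β)).hasDerivAt.comp s h2
    have h4 : deriv (fun s => Real.smoothTransition ((t - s) / β)) s =
      deriv Real.smoothTransition ((t - s) / β) * (-1 / β) := h3.deriv
    rw [h4, abs_mul, abs_div, abs_neg, abs_one, abs_of_pos hβ, mul_one_div]
    gcongr
    exact hMall _

/-! ### The localized heat kernel and its defect in the heat equation. -/

/-- The localized heat kernel centred at `h`. -/
noncomputable def cutoffKernel (χ : ℝ → ℝ) (h τ z : ℝ) : ℝ := χ z * heatKernel τ (z - h)

/-- The defect of the localized heat kernel in the heat equation. -/
noncomputable def cutoffSource (χ : ℝ → ℝ) (h τ z : ℝ) : ℝ :=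
  deriv (deriv χ) z * heatKernel τ (z - h) + 2 * deriv χ z * heatKernelDeriv τ (z - h)

section

variable {χ : ℝ → ℝ} {ρ Q : ℝ}

lemma IsCutoff.contDiff_deriv (hχ : IsCutoff χ ρ Q) : ContDiff ℝ ∞ (deriv χ) :=
  (contDiff_infty_iff_deriv.1 hχ.smooth).2

lemma IsCutoff.contDiff_deriv_deriv (hχ : IsCutoff χ ρ Q) : ContDiff ℝ ∞ (deriv (deriv χ)) :=
  (contDiff_infty_iff_deriv.1 hχ.contDiff_deriv).2

lemma cutoffKernel_nonneg (hχ : IsCutoff χ ρ Q) (h τ z : ℝ) : 0 ≤ cutoffKernel χ h τ z :=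
  mul_nonneg (hχ.nonneg z) (heatKernel_nonneg _ _)

lemma cutoffKernel_le (hχ : IsCutoff χ ρ Q) (h z : ℝ) {τ : ℝ} (hτ : 0 < τ) :
    cutoffKernel χ h τ z ≤ (√(4 * Real.pi * τ))⁻¹ :=
  (mul_le_of_le_one_left (heatKernel_nonneg _ _) (hχ.le_one z)).trans (heatKernel_le hτ _)

/-- This confines the defect of the localized kernel to `ρ/2 ≤ |z| ≤ ρ`, away from its centre. -/
lemma IsCutoff.deriv_eq_zero (hχ : IsCutoff χ ρ Q) {z : ℝ} (hz : |z| < ρ / 2 ∨ ρ < |z|) :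
    deriv χ z = 0 ∧ deriv (deriv χ) z = 0 := by
  have h : ∃ c : ℝ, χ =ᶠ[𝓝 z] fun _ => c := by
    rcases hz with hz | hz
    · refine ⟨1, ?_⟩
      filter_upwards [(isOpen_lt continuous_abs continuous_const).mem_nhds hz] with y hy
      exact hχ.eq_one y (le_of_lt hy)
    · refine ⟨0, ?_⟩
      filter_upwards [(isOpen_lt continuous_const continuous_abs).mem_nhds hz] with y hy
      exact hχ.eq_zero y (le_of_lt hy)
  obtain ⟨c, hc⟩ := h
  have h1 : deriv χ =ᶠ[𝓝 z] fun _ => 0 := by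
    have := hc.deriv
    simpa using this
  exact ⟨h1.eq_of_nhds, by rw [h1.deriv_eq, deriv_const]⟩

lemma hasDerivAt_cutoffKernel (hχ : IsCutoff χ ρ Q) (h τ z : ℝ) :
    HasDerivAt (cutoffKernel χ h τ)
      (deriv χ z * heatKernel τ (z - h) + χ z * heatKernelDeriv τ (z - h)) z := by
  have h1 := (hχ.smooth.differentiable (by simp) z).hasDerivAt
  exact h1.mul ((hasDerivAt_heatKernel τ (z - h)).comp_sub_const z h)

/-- The last term is the time derivative from `hasDerivAt_cutoffKernel_time`, so `cutoffSource` is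
all that is left of the heat equation. -/
lemma deriv_deriv_cutoffKernel (hχ : IsCutoff χ ρ Q) (h τ z : ℝ) :
    deriv (deriv (cutoffKernel χ h τ)) z = cutoffSource χ h τ z +
      χ z * (((z - h) ^ 2 / (4 * τ ^ 2) - 1 / (2 * τ)) * heatKernel τ (z - h)) := by
  have h0 : deriv (cutoffKernel χ h τ) = fun z =>
      deriv χ z * heatKernel τ (z - h) + χ z * heatKernelDeriv τ (z - h) :=
    funext fun z => (hasDerivAt_cutoffKernel hχ h τ z).deriv
  have h1 := (hχ.smooth.differentiable (by simp) z).hasDerivAt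
  have h2 := (hχ.contDiff_deriv.differentiable (by simp) z).hasDerivAt
  have h3 := (h2.mul ((hasDerivAt_heatKernel τ (z - h)).comp_sub_const z h)).add
    (h1.mul ((hasDerivAt_heatKernelDeriv τ (z - h)).comp_sub_const z h))
  rw [h0]
  refine h3.deriv.trans ?_
  unfold cutoffSource
  ring

lemma hasDerivAt_cutoffKernel_time (χ : ℝ → ℝ) (h z : ℝ) {τ : ℝ} (hτ : 0 < τ) :
    HasDerivAt (fun τ => cutoffKernel χ h τ z)
      (χ z * (((z - h) ^ 2 / (4 * τ ^ 2) - 1 / (2 * τ)) * heatKernel τ (z - h))) τ :=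
  (hasDerivAt_heatKernel_time hτ (z - h)).const_mul (χ z)

lemma contDiff_cutoffKernel (hχ : IsCutoff χ ρ Q) (h τ : ℝ) :
    ContDiff ℝ ∞ (cutoffKernel χ h τ) := by
  have h1 : ContDiff ℝ ∞ (heatKernel τ) := by
    rw [heatKernel_eq]
    fun_prop
  exact hχ.smooth.mul (h1.comp (contDiff_id.sub contDiff_const))

lemma contDiffAt_heatKernel {τ : ℝ} (hτ : 0 < τ) (z : ℝ) :
    ContDiffAt ℝ ∞ (Function.uncurry heatKernel) (τ, z) := by
  have h1 : ContDiffAt ℝ ∞ (fun q : ℝ × ℝ => √(4 * Real.pi * q.1)) (τ, z) :=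
    (contDiffAt_const.mul contDiffAt_fst).sqrt (by positivity)
  have h2 : ContDiffAt ℝ ∞ (fun q : ℝ × ℝ => -q.2 ^ 2 / (4 * q.1)) (τ, z) :=
    (contDiffAt_snd.pow 2).neg.div (contDiffAt_const.mul contDiffAt_fst) (by positivity)
  exact (h1.inv (by positivity)).mul h2.exp

/-- The defect of the localized heat kernel is small for small times. -/
lemma exists_abs_cutoffSource_le (hχ : IsCutoff χ ρ Q) (hρ : 0 < ρ) :
    ∃ C, 0 ≤ C ∧ ∀ τ h z : ℝ, 0 < τ → τ ≤ 1 → |h| ≤ ρ / 4 →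
      |cutoffSource χ h τ z| ≤ C * τ ^ 2 := by
  obtain ⟨M₁, hM₁⟩ := (isCompact_Icc (a := -ρ) (b := ρ)).exists_bound_of_continuousOn
    hχ.contDiff_deriv.continuous.continuousOn
  obtain ⟨M₂, hM₂⟩ := (isCompact_Icc (a := -ρ) (b := ρ)).exists_bound_of_continuousOn
    hχ.contDiff_deriv_deriv.continuous.continuousOn
  have h0 : (0 : ℝ) ∈ Icc (-ρ) ρ := ⟨by linarith, hρ.le⟩
  have hM₁0 : 0 ≤ M₁ := (norm_nonneg _).trans (hM₁ 0 h0)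
  have hM₂0 : 0 ≤ M₂ := (norm_nonneg _).trans (hM₂ 0 h0)
  -- Where `χ` varies, `|z - h| ≥ ρ/4`, so the eighth-power bound (`48 = 2 · 4!`) gives a kernel of
  -- size `A τ³`. One power of `τ` is lost to the derivative, leaving `τ²`; this still beats the
  -- factor `1/τ` by which the other kernel is bounded later.
  set A := 48 * 8 ^ 4 / (ρ / 4) ^ 8 with hA
  have hA0 : 0 ≤ A := by positivity
  refine ⟨M₂ * A + 2 * M₁ * (ρ * A), by positivity, fun τ h z hτ hτ1 hh => ?_⟩
  by_cases hz : |z| < ρ / 2 ∨ ρ < |z|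
  · obtain ⟨h1, h2⟩ := hχ.deriv_eq_zero hz
    rw [cutoffSource, h1, h2]
    simp only [zero_mul, mul_zero, add_zero, abs_zero]
    positivity
  push Not at hz
  obtain ⟨hz1, hz2⟩ := hz
  have hzI : z ∈ Icc (-ρ) ρ := abs_le.1 hz2
  have hd : ρ / 4 ≤ |z - h| := by
    have := abs_sub_abs_le_abs_sub z h
    linarith
  have hd2 : |z - h| ≤ 2 * ρ := (abs_sub _ _).trans (by linarith)
  have hg : heatKernel τ (z - h) ≤ A * τ ^ 3 := by
    have h1 := pow_mul_heatKernel_le hτ 4 (z - h)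
    norm_num [Nat.factorial] at h1
    have h2 : heatKernel (2 * τ) (z - h) ≤ τ⁻¹ := by
      refine (heatKernel_le (by positivity) _).trans (inv_anti₀ hτ ?_)
      refine Real.le_sqrt_of_sq_le ?_
      nlinarith [Real.pi_gt_three]
    have h3 : (ρ / 4) ^ 8 ≤ (z - h) ^ 8 := by
      calc (ρ / 4) ^ 8 ≤ |z - h| ^ 8 := by gcongr
        _ = (z - h) ^ 8 := by rw [← abs_pow, abs_of_nonneg (by positivity)]
    have h4 : (ρ / 4) ^ 8 * heatKernel τ (z - h) ≤ 48 * 8 ^ 4 * τ ^ 3 := by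
      calc (ρ / 4) ^ 8 * heatKernel τ (z - h) ≤ (z - h) ^ 8 * heatKernel τ (z - h) :=
            mul_le_mul_of_nonneg_right h3 (heatKernel_nonneg _ _)
        _ ≤ _ := h1
        _ ≤ 48 * (8 * τ) ^ 4 * τ⁻¹ := by gcongr
        _ = _ := by field_simp
    rw [hA, div_mul_eq_mul_div, le_div_iff₀ (by positivity)]
    linarith
  have hgd : |heatKernelDeriv τ (z - h)| ≤ ρ * A * τ ^ 2 := by
    unfold heatKernelDeriv
    rw [abs_mul, abs_neg, abs_div, abs_of_nonneg (heatKernel_nonneg τ (z - h)),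
      abs_of_pos (by positivity : 0 < 2 * τ)]
    calc |z - h| / (2 * τ) * heatKernel τ (z - h) ≤ 2 * ρ / (2 * τ) * (A * τ ^ 3) := by
          gcongr
          exact heatKernel_nonneg _ _
      _ = _ := by field_simp
  have hb1 : |deriv χ z| ≤ M₁ := hM₁ z hzI
  have hb2 : |deriv (deriv χ) z| ≤ M₂ := hM₂ z hzI
  unfold cutoffSource
  calc _ ≤ |deriv (deriv χ) z| * heatKernel τ (z - h) +
        2 * |deriv χ z| * |heatKernelDeriv τ (z - h)| := by
        refine (abs_add_le _ _).trans (le_of_eq ?_)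
        rw [abs_mul, abs_mul, abs_mul, abs_of_nonneg (heatKernel_nonneg τ (z - h)), abs_two]
    _ ≤ M₂ * (A * τ ^ 3) + 2 * M₁ * (ρ * A * τ ^ 2) := by
        gcongr
        exact heatKernel_nonneg _ _
    _ ≤ M₂ * (A * τ ^ 2) + 2 * M₁ * (ρ * A * τ ^ 2) := by
        have : τ ^ 3 ≤ τ ^ 2 := pow_le_pow_of_le_one hτ.le hτ1 (by norm_num)
        gcongr
    _ = _ := by ring

end

/-! ### Frame coordinates and the localized backward heat kernel in the plane. -/

section Frame

variable (p : Plane) (e : OrthonormalBasis (Fin 2) ℝ Plane)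

/-- The coordinates of a point in the orthonormal frame `e` with origin `p`. -/
noncomputable def frameCoord (i : Fin 2) (y : Plane) : ℝ := inner ℝ (e i) (y - p)

lemma frameCoord_add_smul (i j : Fin 2) (y : Plane) (c : ℝ) :
    frameCoord p e i (y + c • e j) = frameCoord p e i y + if i = j then c else 0 := by
  have := orthonormal_iff_ite.1 e.orthonormal i j
  rw [frameCoord, frameCoord, add_sub_right_comm, inner_add_right, inner_smul_right, this]
  simp

lemma frameCoord_framePoint_zero (x y : ℝ) : frameCoord p e 0 (framePoint p e x y) = x := by
  simp [framePoint, frameCoord_add_smul]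
  simp [frameCoord]

lemma frameCoord_framePoint_one (x y : ℝ) : frameCoord p e 1 (framePoint p e x y) = y := by
  simp [framePoint, frameCoord_add_smul]
  simp [frameCoord]

lemma framePoint_frameCoord (y : Plane) :
    framePoint p e (frameCoord p e 0 y) (frameCoord p e 1 y) = y := by
  have h := e.sum_repr' (y - p)
  rw [Fin.sum_univ_two] at h
  rw [framePoint, add_assoc]
  unfold frameCoord
  rw [h, add_sub_cancel]

lemma contDiff_frameCoord (i : Fin 2) : ContDiff ℝ ∞ (frameCoord p e i) := by
  exact contDiff_const.inner ℝ (contDiff_id.sub contDiff_const)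

lemma hasFDerivAt_frameCoord (i : Fin 2) (y : Plane) :
    HasFDerivAt (frameCoord p e i) (innerSL ℝ (e i)) y := by
  have h := (innerSL ℝ (e i)).hasFDerivAt (x := y - p)
  exact h.comp y ((hasFDerivAt_id y).sub_const p)

lemma continuous_framePoint : Continuous fun z : ℝ × ℝ => framePoint p e z.1 z.2 := by
  unfold framePoint
  fun_prop

lemma dist_framePoint_le (x y : ℝ) : dist (framePoint p e x y) p ≤ |x| + |y| := by
  rw [framePoint, dist_eq_norm, add_assoc, add_sub_cancel_left]
  refine (norm_add_le _ _).trans ?_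
  simp [norm_smul]

lemma dist_framePoint_sq (x y x' y' : ℝ) :
    dist (framePoint p e x y) (framePoint p e x' y') ^ 2 = (x - x') ^ 2 + (y - y') ^ 2 := by
  have h : framePoint p e x y - framePoint p e x' y' = (x - x') • e 0 + (y - y') • e 1 := by
    unfold framePoint
    module
  have h01 : inner ℝ (e 0) (e 1) = (0 : ℝ) := e.orthonormal.2 (by decide)
  rw [dist_eq_norm, h, norm_add_sq_real, norm_smul, norm_smul, inner_smul_left, inner_smul_right,
    h01]
  simp

/-- The frame coordinates preserve the Lebesgue measure. -/
lemma measurePreserving_frameCoord :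
    MeasurePreserving (fun y => (frameCoord p e 0 y, frameCoord p e 1 y)) := by
  have h1 := (measurePreserving_sub_right (volume : Measure Plane) p)
  have h2 := e.measurePreserving_repr.comp h1
  have h3 := (PiLp.volume_preserving_ofLp (Fin 2)).comp h2
  have h4 := (volume_preserving_finTwoArrow ℝ).comp h3
  convert! h4 using 1
  funext y
  simp [frameCoord, e.repr_apply_apply, MeasurableEquiv.finTwoArrow, inner_sub_right]

/-- The frame coordinates as a measurable equivalence. -/
noncomputable def frameEquiv : ℝ × ℝ ≃ᵐ Plane where
  toFun z := framePoint p e z.1 z.2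
  invFun y := (frameCoord p e 0 y, frameCoord p e 1 y)
  left_inv z := by simp [frameCoord_framePoint_zero, frameCoord_framePoint_one]
  right_inv y := framePoint_frameCoord p e y
  measurable_toFun := (continuous_framePoint p e).measurable
  measurable_invFun := (measurePreserving_frameCoord p e).measurable

lemma measurePreserving_frameEquiv : MeasurePreserving (frameEquiv p e) :=
  (measurePreserving_frameCoord p e).symm (frameEquiv p e).symm

lemma integral_framePoint (f : Plane → ℝ) :
    ∫ z : ℝ × ℝ, f (framePoint p e z.1 z.2) = ∫ y, f y :=
  (measurePreserving_frameEquiv p e).integral_comp' f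

lemma hasFDerivAt_mul_frameCoord {f g : ℝ → ℝ} {f' g' : ℝ} {y : Plane}
    (hf : HasDerivAt f f' (frameCoord p e 0 y)) (hg : HasDerivAt g g' (frameCoord p e 1 y)) :
    HasFDerivAt (fun y => f (frameCoord p e 0 y) * g (frameCoord p e 1 y))
      (f (frameCoord p e 0 y) • g' • innerSL ℝ (e 1) +
        g (frameCoord p e 1 y) • f' • innerSL ℝ (e 0)) y :=
  (hf.comp_hasFDerivAt y (hasFDerivAt_frameCoord p e 0 y)).mul
    (hg.comp_hasFDerivAt y (hasFDerivAt_frameCoord p e 1 y))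

/-- The Laplacian of a product of functions of one frame coordinate each. -/
lemma laplacian_mul_frameCoord {f g : ℝ → ℝ} (hf : ContDiff ℝ ∞ f) (hg : ContDiff ℝ ∞ g)
    (y : Plane) :
    Laplacian.laplacian (fun y => f (frameCoord p e 0 y) * g (frameCoord p e 1 y)) y =
      deriv (deriv f) (frameCoord p e 0 y) * g (frameCoord p e 1 y) +
        f (frameCoord p e 0 y) * deriv (deriv g) (frameCoord p e 1 y) := by
  have hd : ∀ {k : ℝ → ℝ}, ContDiff ℝ ∞ k → ∀ x, HasDerivAt k (deriv k x) x := fun hk x =>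
    (hk.differentiable (by simp) x).hasDerivAt
  have hf' : ContDiff ℝ ∞ (deriv f) := (contDiff_infty_iff_deriv.1 hf).2
  have hg' : ContDiff ℝ ∞ (deriv g) := (contDiff_infty_iff_deriv.1 hg).2
  have h00 : inner ℝ (e 0) (e 0) = (1 : ℝ) := by simp
  have h11 : inner ℝ (e 1) (e 1) = (1 : ℝ) := by simp
  have h01 : inner ℝ (e 0) (e 1) = (0 : ℝ) := e.orthonormal.2 (by decide)
  have h10 : inner ℝ (e 1) (e 0) = (0 : ℝ) := e.orthonormal.2 (by decide)
  set F : Plane → ℝ := fun y => f (frameCoord p e 0 y) * g (frameCoord p e 1 y) with hF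
  have hFs : ContDiff ℝ ∞ F :=
    (hf.comp (contDiff_frameCoord p e 0)).mul (hg.comp (contDiff_frameCoord p e 1))
  have hF1 : Differentiable ℝ (fderiv ℝ F) :=
    (contDiff_infty_iff_fderiv.1 hFs).2.differentiable (by simp)
  have hF' : fderiv ℝ F = fun y => f (frameCoord p e 0 y) • deriv g (frameCoord p e 1 y) •
      innerSL ℝ (e 1) + g (frameCoord p e 1 y) • deriv f (frameCoord p e 0 y) • innerSL ℝ (e 0) :=
    funext fun y => (hasFDerivAt_mul_frameCoord p e (hd hf _) (hd hg _)).fderiv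
  have hcomm : ∀ v : Plane, fderiv ℝ (fderiv ℝ F) y v v =
      fderiv ℝ (fun y => fderiv ℝ F y v) y v := by
    intro v
    rw [fderiv_clm_apply (hF1 y) (differentiableAt_const v)]
    simp
  rw [InnerProductSpace.laplacian_eq_iteratedFDeriv_orthonormalBasis F e]
  simp only [Fin.sum_univ_two, iteratedFDeriv_two_apply]
  simp only [Matrix.cons_val_zero, Matrix.cons_val_one]
  rw [hcomm, hcomm, hF']
  have g0 : (fun y => (f (frameCoord p e 0 y) • deriv g (frameCoord p e 1 y) • innerSL ℝ (e 1) +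
      g (frameCoord p e 1 y) • deriv f (frameCoord p e 0 y) • innerSL ℝ (e 0)) (e 0)) =
      fun y => deriv f (frameCoord p e 0 y) * g (frameCoord p e 1 y) := by
    funext y
    simp [h10, mul_comm]
  have g1 : (fun y => (f (frameCoord p e 0 y) • deriv g (frameCoord p e 1 y) • innerSL ℝ (e 1) +
      g (frameCoord p e 1 y) • deriv f (frameCoord p e 0 y) • innerSL ℝ (e 0)) (e 1)) =
      fun y => f (frameCoord p e 0 y) * deriv g (frameCoord p e 1 y) := by
    funext y
    simp [h01]
  rw [g0, g1, (hasFDerivAt_mul_frameCoord p e (hd hf' _) (hd hg _)).fderiv,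
    (hasFDerivAt_mul_frameCoord p e (hd hf _) (hd hg' _)).fderiv]
  simp [h01, h10, mul_comm]

/-- The localized backward heat kernel with pole `(b, (0, h))` in frame coordinates. -/
noncomputable def backwardKernel (η χ : ℝ → ℝ) (b h s : ℝ) (y : Plane) : ℝ :=
  η s * (cutoffKernel χ 0 (b - s) (frameCoord p e 0 y) *
    cutoffKernel χ h (b - s) (frameCoord p e 1 y))

/-- The defect of the localized kernel `cutoffKernel χ 0 τ x * cutoffKernel χ h τ y`. -/
noncomputable def kernelDefect (χ : ℝ → ℝ) (h τ x y : ℝ) : ℝ :=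
  cutoffSource χ 0 τ x * cutoffKernel χ h τ y + cutoffKernel χ 0 τ x * cutoffSource χ h τ y

variable {χ η : ℝ → ℝ} {ρ Q t β M : ℝ}

lemma isTestFunction_backwardKernel (hχ : IsCutoff χ ρ Q) (hη : IsTimeCutoff η t β M)
    {T b : ℝ} (hb : t < b) (htT : t < T) (h : ℝ) :
    IsTestFunction T (backwardKernel p e η χ b h) := by
  have hsub : Function.support (Function.uncurry (backwardKernel p e η χ b h)) ⊆
      Icc (-2) t ×ˢ Metric.closedBall p (2 * ρ) := by
    rintro ⟨s, y⟩ hsy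
    rw [Function.mem_support] at hsy
    simp only [Function.uncurry, backwardKernel, cutoffKernel, ne_eq, mul_eq_zero, not_or] at hsy
    obtain ⟨h1, ⟨h2, -⟩, h3, -⟩ := hsy
    refine ⟨⟨?_, ?_⟩, ?_⟩
    · by_contra hc
      exact h1 (hη.eq_zero' s (not_le.1 hc).le)
    · by_contra hc
      exact h1 (hη.eq_zero s (not_le.1 hc).le)
    · have h2' : |frameCoord p e 0 y| < ρ := not_le.1 fun hc => h2 (hχ.eq_zero _ hc)
      have h3' : |frameCoord p e 1 y| < ρ := not_le.1 fun hc => h3 (hχ.eq_zero _ hc)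
      have h4 := dist_framePoint_le p e (frameCoord p e 0 y) (frameCoord p e 1 y)
      rw [framePoint_frameCoord] at h4
      rw [Metric.mem_closedBall]
      linarith
  have hK : IsCompact (Icc (-2) t ×ˢ Metric.closedBall p (2 * ρ)) :=
    isCompact_Icc.prod (isCompact_closedBall p (2 * ρ))
  refine ⟨?_, HasCompactSupport.of_support_subset_isCompact hK hsub, ?_⟩
  · rw [contDiff_iff_contDiffAt]
    rintro ⟨s, y⟩
    rcases lt_or_ge s b with hs | hs
    · have hA : ∀ (i : Fin 2) (h : ℝ), ContDiffAt ℝ ∞ (fun q : ℝ × Plane =>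
          cutoffKernel χ h (b - q.1) (frameCoord p e i q.2)) (s, y) := by
        intro i h
        have hc : ContDiff ℝ ∞ fun q : ℝ × Plane => frameCoord p e i q.2 :=
          (contDiff_frameCoord p e i).comp contDiff_snd
        refine (hχ.smooth.comp hc).contDiffAt.mul ?_
        have hk := contDiffAt_heatKernel (sub_pos.2 hs) (frameCoord p e i y - h)
        exact ContDiffAt.comp (s, y)
          (f := fun q : ℝ × Plane => (b - q.1, frameCoord p e i q.2 - h)) hk
          ((contDiff_const.sub contDiff_fst).prodMk (hc.sub contDiff_const)).contDiffAt
      exact (hη.smooth.comp contDiff_fst).contDiffAt.mul ((hA 0 0).mul (hA 1 h))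
    -- From the pole time `b` on, `heatKernel` has no meaning, but `η` has vanished since `t < b`.
    · have hz : Function.uncurry (backwardKernel p e η χ b h) =ᶠ[𝓝 (s, y)] fun _ => 0 := by
        filter_upwards [continuousAt_fst.preimage_mem_nhds (Ioi_mem_nhds (hb.trans_le hs))]
          with q hq
        simp only [Function.uncurry, backwardKernel]
        rw [hη.eq_zero q.1 (le_of_lt hq), zero_mul]
      exact contDiffAt_const.congr_of_eventuallyEq hz
  · refine (closure_minimal hsub hK.isClosed).trans ?_
    rintro ⟨s, y⟩ ⟨hs, -⟩
    exact ⟨lt_of_le_of_lt hs.2 htT, mem_univ _⟩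

/-- The localized backward heat kernel solves the backward heat equation up to its defect. -/
lemma deriv_add_laplacian_backwardKernel (hχ : IsCutoff χ ρ Q) (hη : IsTimeCutoff η t β M)
    {b : ℝ} (hb : t < b) (h s : ℝ) (y : Plane) :
    deriv (fun s => backwardKernel p e η χ b h s y) s +
      Laplacian.laplacian (backwardKernel p e η χ b h s) y =
    deriv η s * (cutoffKernel χ 0 (b - s) (frameCoord p e 0 y) *
      cutoffKernel χ h (b - s) (frameCoord p e 1 y)) +
    η s * kernelDefect χ h (b - s) (frameCoord p e 0 y) (frameCoord p e 1 y) := by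
  have hlap : Laplacian.laplacian (backwardKernel p e η χ b h s) y = η s *
      (deriv (deriv (cutoffKernel χ 0 (b - s))) (frameCoord p e 0 y) *
        cutoffKernel χ h (b - s) (frameCoord p e 1 y) +
      cutoffKernel χ 0 (b - s) (frameCoord p e 0 y) *
        deriv (deriv (cutoffKernel χ h (b - s))) (frameCoord p e 1 y)) := by
    have hc0 := contDiff_cutoffKernel hχ 0 (b - s)
    have hc1 := contDiff_cutoffKernel hχ h (b - s)
    rw [← laplacian_mul_frameCoord p e hc0 hc1, ← smul_eq_mul (η s),
      ← InnerProductSpace.laplacian_smul]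
    · rfl
    · exact (contDiff_infty.1 ((hc0.comp (contDiff_frameCoord p e 0)).mul
        (hc1.comp (contDiff_frameCoord p e 1))) 2).contDiffAt
  rcases lt_or_ge s b with hs | hs
  · have hbs : 0 < b - s := sub_pos.2 hs
    have hcomp : HasDerivAt (fun s => b - s) (-1) s := (hasDerivAt_id s).const_sub b
    have h0 := (hasDerivAt_cutoffKernel_time χ 0 (frameCoord p e 0 y) hbs).comp s hcomp
    have h1 := (hasDerivAt_cutoffKernel_time χ h (frameCoord p e 1 y) hbs).comp s hcomp
    have hηd := (hη.smooth.differentiable (by simp) s).hasDerivAt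
    have hd := (hηd.mul (h0.mul h1)).deriv
    have hd' : deriv (fun s => backwardKernel p e η χ b h s y) s = _ := hd
    -- The kernel runs in `b - s`, so its time derivative enters with a minus sign and cancels the
    -- heat-equation terms of both second derivatives.
    rw [hd', hlap, deriv_deriv_cutoffKernel hχ, deriv_deriv_cutoffKernel hχ]
    simp only [Function.comp_apply, kernelDefect, cutoffKernel, Pi.mul_apply]
    ring
  · have hst : t < s := hb.trans_le hs
    have hz : η =ᶠ[𝓝 s] fun _ => 0 := by
      filter_upwards [Ioi_mem_nhds hst] with r hr
      exact hη.eq_zero r (le_of_lt hr)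
    have hz2 : (fun s => backwardKernel p e η χ b h s y) =ᶠ[𝓝 s] fun _ => 0 := by
      filter_upwards [hz] with r hr
      rw [backwardKernel, hr, zero_mul]
    rw [hlap, hz2.deriv_eq, hz.deriv_eq, hη.eq_zero s hst.le]
    simp

end Frame

/-! ### Length integrals over a nearly flat graph. -/

section Graph

variable (p : Plane) (e : OrthonormalBasis (Fin 2) ℝ Plane)

lemma lipschitzWith_frameCoord (i : Fin 2) : LipschitzWith 1 (frameCoord p e i) := by
  refine LipschitzWith.of_dist_le_mul fun x y => ?_
  rw [NNReal.coe_one, one_mul, Real.dist_eq, dist_eq_norm, frameCoord, frameCoord,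
    ← inner_sub_right, sub_sub_sub_cancel_right]
  exact (abs_real_inner_le_norm _ _).trans (by simp)

/-- Integrals over a nearly flat graph with respect to length are comparable to integrals over
its projection. -/
lemma setIntegral_graph_mem_Icc {F : Set Plane} {ρ r ε B : ℝ}
    {f : ℝ → ℝ} (hε : 0 ≤ ε) (hρr : ρ ≤ r)
    (hF : ∀ x ∈ Ioo (-ρ) ρ, ∀ y ∈ Ioo (-r) r, (framePoint p e x y ∈ F ↔ y = f x))
    (hfr : ∀ x ∈ Ioo (-ρ) ρ, f x ∈ Ioo (-r) r)
    (hLip : ∀ x ∈ Ioo (-ρ) ρ, ∀ x' ∈ Ioo (-ρ) ρ, |f x - f x'| ≤ ε * |x - x'|)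
    {G : Plane → ℝ} (hG : Continuous G) (hG0 : ∀ y, 0 ≤ G y) (hGB : ∀ y, G y ≤ B)
    (hGs : ∀ y, G y ≠ 0 → |frameCoord p e 0 y| < ρ ∧ |frameCoord p e 1 y| < ρ)
    (hFm : MeasurableSet F) :
    ∫ y in F, G y ∂(Measure.hausdorffMeasure 1) ∈
      Icc (∫ x in Ioo (-ρ) ρ, G (framePoint p e x (f x)))
        ((1 + ε) * ∫ x in Ioo (-ρ) ρ, G (framePoint p e x (f x))) := by
  set I := Ioo (-ρ) ρ with hI
  set Γ : ℝ → Plane := fun x => framePoint p e x (f x) with hΓ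
  set V : Set Plane := {y | frameCoord p e 0 y ∈ I ∧ frameCoord p e 1 y ∈ Ioo (-r) r} with hV
  have hVm : MeasurableSet V :=
    ((contDiff_frameCoord p e 0).continuous.measurable measurableSet_Ioo).inter
      ((contDiff_frameCoord p e 1).continuous.measurable measurableSet_Ioo)
  have himg : ∀ E : Set Plane, E ∩ (F ∩ V) = Γ '' (Γ ⁻¹' E ∩ I) := by
    intro E
    ext y
    constructor
    · rintro ⟨hyE, hyF, hy0, hy1⟩
      have h1 : frameCoord p e 1 y = f (frameCoord p e 0 y) := by
        rw [← hF _ hy0 _ hy1, framePoint_frameCoord]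
        exact hyF
      have h2 : Γ (frameCoord p e 0 y) = y := by
        rw [hΓ]
        simp only
        rw [← h1, framePoint_frameCoord]
      exact ⟨frameCoord p e 0 y, ⟨by rw [mem_preimage, h2]; exact hyE, hy0⟩, h2⟩
    · rintro ⟨x, ⟨hxE, hxI⟩, rfl⟩
      refine ⟨hxE, (hF x hxI _ (hfr x hxI)).2 rfl, ?_, ?_⟩
      · rw [hΓ]
        simp only
        rw [frameCoord_framePoint_zero]
        exact hxI
      · rw [hΓ]
        simp only
        rw [frameCoord_framePoint_one]
        exact hfr x hxI
  -- The graph map has Lipschitz constant at most `√(1 + ε²) ≤ 1 + ε`.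
  set K : NNReal := ⟨1 + ε, by linarith⟩ with hK
  have hΓL : LipschitzOnWith K Γ I := by
    refine LipschitzOnWith.of_dist_le_mul fun x hx x' hx' => ?_
    have h1 := dist_framePoint_sq p e x (f x) x' (f x')
    have h2 := hLip x hx x' hx'
    rw [Real.dist_eq]
    refine abs_le_of_sq_le_sq' ?_ (by positivity) |>.2
    have h3 : (f x - f x') ^ 2 ≤ (ε * |x - x'|) ^ 2 := by
      rw [← sq_abs]; exact pow_le_pow_left₀ (abs_nonneg _) h2 2
    have h4 : |x - x'| ^ 2 = (x - x') ^ 2 := sq_abs _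
    change dist (framePoint p e x (f x)) (framePoint p e x' (f x')) ^ 2 ≤ ((1 + ε) * |x - x'|) ^ 2
    rw [h1]
    nlinarith [mul_nonneg hε (sq_nonneg (x - x'))]
  have hΓm : AEMeasurable Γ (volume.restrict I) :=
    (hΓL.continuousOn.aestronglyMeasurable measurableSet_Ioo).aemeasurable
  set ν : Measure Plane := Measure.map Γ (volume.restrict I) with hν
  set μ : Measure Plane := (Measure.hausdorffMeasure 1 : Measure Plane).restrict (F ∩ V) with hμ
  have hνE : ∀ E, MeasurableSet E → ν E = volume (Γ ⁻¹' E ∩ I) := by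
    intro E hE
    rw [hν, Measure.map_apply_of_aemeasurable hΓm hE, Measure.restrict_apply' measurableSet_Ioo]
  have hμE : ∀ E, MeasurableSet E → μ E = Measure.hausdorffMeasure 1 (Γ '' (Γ ⁻¹' E ∩ I)) := by
    intro E hE
    rw [hμ, Measure.restrict_apply hE, himg]
  -- The first coordinate is 1-Lipschitz and inverts the graph map, so length dominates the length
  -- of the projection. The converse bound `hupp` uses that the graph map is `K`-Lipschitz; no area
  -- formula is involved.
  have hlow : ν ≤ μ := by
    refine Measure.le_iff.2 fun E hE => ?_
    rw [hνE E hE, hμE E hE]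
    have h1 := (lipschitzWith_frameCoord p e 0).hausdorffMeasure_image_le (d := 1) zero_le_one
      (Γ '' (Γ ⁻¹' E ∩ I))
    have h2 : frameCoord p e 0 '' (Γ '' (Γ ⁻¹' E ∩ I)) = Γ ⁻¹' E ∩ I := by
      rw [image_image]
      have : (fun x => frameCoord p e 0 (Γ x)) = id := by
        funext x
        exact frameCoord_framePoint_zero p e x (f x)
      rw [this, image_id]
    rw [h2, hausdorffMeasure_real] at h1
    simpa using h1
  have hupp : μ ≤ K • ν := by
    refine Measure.le_iff.2 fun E hE => ?_
    rw [Measure.smul_apply, hνE E hE, hμE E hE]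
    have h1 := (hΓL.mono (inter_subset_right (s := Γ ⁻¹' E))).hausdorffMeasure_image_le (d := 1)
      zero_le_one
    rw [hausdorffMeasure_real, ENNReal.rpow_one] at h1
    exact h1
  have hνfin : IsFiniteMeasure ν := by
    rw [hν]
    infer_instance
  have hμfin : IsFiniteMeasure μ := isFiniteMeasure_of_le (K • ν) hupp
  have hGb : ∀ y, ‖G y‖ ≤ B := fun y => by
    rw [Real.norm_of_nonneg (hG0 y)]
    exact hGB y
  have hGμ : Integrable G μ :=
    (integrable_const B).mono' hG.aestronglyMeasurable (ae_of_all _ hGb)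
  have hGν : Integrable G (K • ν) :=
    (integrable_const B).mono' hG.aestronglyMeasurable (ae_of_all _ hGb)
  have hint : ∫ y, G y ∂ν = ∫ x in I, G (Γ x) :=
    integral_map hΓm hG.aestronglyMeasurable
  -- Outside the box `V`, where `F` is not known to be a graph, `G` vanishes.
  have heq : ∫ y in F, G y ∂(Measure.hausdorffMeasure 1) = ∫ y, G y ∂μ := by
    rw [hμ]
    refine setIntegral_eq_of_subset_of_forall_sdiff_eq_zero hFm inter_subset_left fun y hy => ?_
    by_contra hne
    obtain ⟨h0, h1⟩ := hGs y hne
    have h1' := abs_lt.1 h1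
    exact hy.2 ⟨hy.1, abs_lt.1 h0, by linarith, by linarith⟩
  rw [heq, ← hint]
  constructor
  · exact integral_mono_measure hlow (ae_of_all _ hG0) hGμ
  · refine (integral_mono_measure hupp (ae_of_all _ hG0) hGν).trans (le_of_eq ?_)
    rw [integral_smul_nnreal_measure]
    rfl

end Graph

/-! ### Time integrals, integrability and averages against `η'`. -/

/-- The length density of the heat kernel, integrated in time. -/
lemma integral_inv_sqrt {a c b : ℝ} (hac : a ≤ c) (hcb : c < b) :
    IntegrableOn (fun s => (√(4 * Real.pi * (b - s)))⁻¹) (Ioo a c) ∧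
    ∫ s in Ioo a c, (√(4 * Real.pi * (b - s)))⁻¹ = (√(b - a) - √(b - c)) / √Real.pi := by
  have hpi := Real.pi_pos
  have hpos : ∀ s ∈ uIcc a c, 0 < b - s := fun s hs => by
    rw [uIcc_of_le hac] at hs
    linarith [hs.2]
  have hd : ∀ s ∈ uIcc a c, HasDerivAt (fun s => -(√(b - s) / √Real.pi))
      ((√(4 * Real.pi * (b - s)))⁻¹) s := by
    intro s hs
    have hbs := hpos s hs
    have h1 : HasDerivAt (fun s => b - s) (-1) s := (hasDerivAt_id s).const_sub b
    have h2 := ((h1.sqrt hbs.ne').div_const √Real.pi).neg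
    convert! h2 using 1
    rw [show 4 * Real.pi * (b - s) = 2 ^ 2 * (Real.pi * (b - s)) by ring,
      Real.sqrt_mul (by positivity), Real.sqrt_sq (by norm_num), Real.sqrt_mul hpi.le]
    have : √(b - s) ≠ 0 := by positivity
    have : √Real.pi ≠ 0 := by positivity
    field_simp
  have hc : ContinuousOn (fun s => (√(4 * Real.pi * (b - s)))⁻¹) (uIcc a c) := by
    refine ContinuousOn.inv₀ (by fun_prop) fun s hs => ?_
    have := hpos s hs
    positivity
  have hi := hc.intervalIntegrable (μ := volume)
  have h := intervalIntegral.integral_eq_sub_of_hasDerivAt hd hi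
  rw [intervalIntegral.integral_of_le hac, integral_Ioc_eq_integral_Ioo] at h
  refine ⟨(hc.integrableOn_compact isCompact_uIcc).mono_set ?_, ?_⟩
  · rw [uIcc_of_le hac]
    exact Ioo_subset_Icc_self
  · rw [h]
    ring

/-- As `u` is only locally integrable, kernels are paired with it through a uniform bound and a
bounded support. -/
lemma integrable_mul_of_bounded {u : ℝ → Plane → ℝ} {T R B : ℝ}
    (hu : IntegrableOn (Function.uncurry u) (Ioo 0 T ×ˢ Metric.closedBall 0 R))
    {k : ℝ → Plane → ℝ} (hk : Measurable (Function.uncurry k))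
    (hB : ∀ s ∈ Ioo 0 T, ∀ y, |k s y| ≤ B) (hR : ∀ s y, y ∉ Metric.closedBall 0 R → k s y = 0) :
    Integrable (fun q : ℝ × Plane => u q.1 q.2 * k q.1 q.2)
      ((volume.restrict (Ioo 0 T)).prod volume) ∧
    |∫ s in Ioo 0 T, ∫ y, u s y * k s y| ≤
      B * ∫ q in Ioo 0 T ×ˢ Metric.closedBall (0 : Plane) R, |u q.1 q.2| := by
  have hm : MeasurableSet (Ioo 0 T ×ˢ Metric.closedBall (0 : Plane) R) :=
    measurableSet_Ioo.prod Metric.isClosed_closedBall.measurableSet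
  have hm' : MeasurableSet (Ioo 0 T ×ˢ (univ : Set Plane)) := measurableSet_Ioo.prod .univ
  have hb : ∀ᵐ q ∂(volume.restrict (Ioo 0 T ×ˢ Metric.closedBall (0 : Plane) R)),
      ‖u q.1 q.2 * k q.1 q.2‖ ≤ B * |u q.1 q.2| := by
    filter_upwards [ae_restrict_mem hm] with q hq
    rw [norm_mul, Real.norm_eq_abs, Real.norm_eq_abs, mul_comm]
    exact mul_le_mul_of_nonneg_right (hB q.1 hq.1 q.2) (abs_nonneg _)
  have hub : IntegrableOn (fun q : ℝ × Plane => B * |u q.1 q.2|)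
      (Ioo 0 T ×ˢ Metric.closedBall 0 R) := hu.abs.const_mul B
  have h1 : IntegrableOn (fun q : ℝ × Plane => u q.1 q.2 * k q.1 q.2)
      (Ioo 0 T ×ˢ Metric.closedBall 0 R) :=
    hub.mono' (hu.aestronglyMeasurable.mul hk.aestronglyMeasurable) hb
  have hz : ∀ q ∈ (Ioo 0 T ×ˢ (univ : Set Plane)) \ (Ioo 0 T ×ˢ Metric.closedBall 0 R),
      u q.1 q.2 * k q.1 q.2 = 0 := by
    rintro q ⟨hq1, hq2⟩
    rw [hR q.1 q.2 fun hc => hq2 ⟨hq1.1, hc⟩, mul_zero]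
  have h2 := h1.of_forall_sdiff_eq_zero hm' hz
  have hprod : (volume.restrict (Ioo 0 T ×ˢ (univ : Set Plane)) : Measure (ℝ × Plane)) =
      (volume.restrict (Ioo 0 T)).prod volume := by
    rw [Measure.volume_eq_prod, ← Measure.prod_restrict, Measure.restrict_univ]
  have h3 : Integrable (fun q : ℝ × Plane => u q.1 q.2 * k q.1 q.2)
      ((volume.restrict (Ioo 0 T)).prod volume) := by
    rw [← hprod]
    exact h2
  refine ⟨h3, ?_⟩
  have h4 := integral_prod _ h3
  simp only at h4
  rw [← h4, ← hprod]
  rw [setIntegral_eq_of_subset_of_forall_sdiff_eq_zero hm'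
    (prod_mono_right (subset_univ _)) hz, ← integral_const_mul, ← Real.norm_eq_abs]
  exact norm_integral_le_of_norm_le hub hb

/-- The super-level set of a function continuous at positive times has boundary in the level
set. -/
lemma IsWeakSolution.eq_half_of_mem_frontier {T : ℝ} {lam : ℝ → ℝ} {P₀ : Set Plane}
    {u : ℝ → Plane → ℝ} (hu : IsWeakSolution T lam P₀ u) {t : ℝ} (ht : t ∈ Ioo 0 T) {x : Plane}
    (hx : x ∈ frontier (phase u t)) : u t x = 1 / 2 := by
  have hc : Continuous (u t) := by
    have h1 : ContinuousOn (fun y : Plane => Function.uncurry u (t, y)) univ :=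
      hu.continuousOn.comp (by fun_prop) fun y _ => ⟨ht, mem_univ y⟩
    exact continuousOn_univ.1 h1
  have h := frontier_lt_subset_eq continuous_const hc hx
  exact (h : (1 / 2 : ℝ) = u t x).symm

lemma IsTimeCutoff.setIntegral_deriv {η : ℝ → ℝ} {t β M T : ℝ} (hη : IsTimeCutoff η t β M)
    (hβt : β < t) (hβ : 0 < β) (htT : t < T) : ∫ s in Ioo 0 T, deriv η s = -1 := by
  have hd : Continuous (deriv η) := (contDiff_infty_iff_deriv.1 hη.smooth).2.continuous
  rw [← integral_Ioc_eq_integral_Ioo, ← intervalIntegral.integral_of_le (by linarith),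
    intervalIntegral.integral_deriv_eq_sub (fun x _ => hη.smooth.differentiable (by simp) x)
      (hd.intervalIntegrable _ _), hη.eq_zero T htT.le, hη.eq_one 0 le_rfl (by linarith)]
  norm_num

lemma IsTimeCutoff.deriv_eq_zero_of_lt {η : ℝ → ℝ} {t β M s : ℝ} (hη : IsTimeCutoff η t β M)
    (hs : t < s) : deriv η s = 0 := by
  have : η =ᶠ[𝓝 s] fun _ => 0 := by
    filter_upwards [Ioi_mem_nhds hs] with r hr
    exact hη.eq_zero r (le_of_lt hr)
  rw [this.deriv_eq, deriv_const]

/-- Averages against the derivative of a time cutoff. -/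
lemma IsTimeCutoff.abs_setIntegral_deriv_mul_add_le {η : ℝ → ℝ} {t β M T : ℝ}
    (hη : IsTimeCutoff η t β M) (hM : 0 ≤ M) (hβt : β < t) (hβ : 0 < β) (htT : t < T)
    {m : ℝ → ℝ} {w c : ℝ} (hm : ∀ s ∈ Icc (t - β) t, |m s - w| ≤ c)
    (hint : IntegrableOn (fun s => deriv η s * m s) (Ioo 0 T)) :
    |(∫ s in Ioo 0 T, deriv η s * m s) + w| ≤ M * c := by
  have hd : Continuous (deriv η) := (contDiff_infty_iff_deriv.1 hη.smooth).2.continuous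
  have hdi : IntegrableOn (fun s => deriv η s * w) (Ioo 0 T) :=
    ((hd.mul continuous_const).integrableOn_Icc).mono_set Ioo_subset_Icc_self
  have hc : 0 ≤ c := (abs_nonneg _).trans (hm t ⟨by linarith, le_rfl⟩)
  have h1 : (∫ s in Ioo 0 T, deriv η s * m s) + w =
      ∫ s in Ioo 0 T, (deriv η s * m s - deriv η s * w) := by
    rw [integral_sub hint hdi, integral_mul_const, hη.setIntegral_deriv hβt hβ htT]
    ring
  have hzero : ∀ s ∈ Ioo 0 T \ Icc (t - β) t, deriv η s * m s - deriv η s * w = 0 := by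
    rintro s ⟨hs, hs'⟩
    have : deriv η s = 0 := by
      rcases lt_or_ge s (t - β) with h | h
      · exact hη.deriv_eq_zero s hs.1 h
      · exact hη.deriv_eq_zero_of_lt (not_le.1 fun hc => hs' ⟨h, hc⟩)
    rw [this]
    ring
  rw [h1, setIntegral_eq_of_subset_of_forall_sdiff_eq_zero measurableSet_Ioo
    (s := Icc (t - β) t) (fun s hs => ⟨by linarith [hs.1], by linarith [hs.2]⟩) hzero,
    ← Real.norm_eq_abs]
  -- The bound `M / β` for `η'` is compensated by the length `β` of the window.
  refine (norm_setIntegral_le_of_norm_le_const (C := M / β * c) (by simp) ?_).trans ?_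
  · intro s hs
    rw [← mul_sub, norm_mul]
    exact mul_le_mul (hη.abs_deriv_le s (by linarith [hs.1])) (hm s hs) (norm_nonneg _)
      (by positivity)
  · rw [Real.volume_real_Icc_of_le (by linarith)]
    refine le_of_eq ?_
    field_simp
    ring

/-! ### Recovery of pointwise values from heat averages. -/

section

variable (p : Plane) (e : OrthonormalBasis (Fin 2) ℝ Plane) {χ : ℝ → ℝ} {ρ Q : ℝ}

/-- The localized heat average of `u s` at distance `b - s` in time. -/
noncomputable def heatAverage (u : ℝ → Plane → ℝ) (χ : ℝ → ℝ) (b h s : ℝ) : ℝ :=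
  ∫ y, u s y * (cutoffKernel χ 0 (b - s) (frameCoord p e 0 y) *
    cutoffKernel χ h (b - s) (frameCoord p e 1 y))

/-- Heat averages recover the value of a continuous function. -/
lemma eventually_abs_heatAverage_sub_le {u : ℝ → Plane → ℝ} {T : ℝ}
    (hu : ContinuousOn (Function.uncurry u) (Ioo 0 T ×ˢ univ)) (hχ : IsCutoff χ ρ Q)
    {t h : ℝ} (ht : t ∈ Ioo 0 T) (hh : |h| ≤ ρ / 2) {c : ℝ} (hc : 0 < c) :
    ∀ᶠ β in 𝓝[>] (0 : ℝ), ∀ s ∈ Icc (t - β) t,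
      |heatAverage p e u χ (t + β) h s - u t (framePoint p e 0 h)| ≤ c := by
  -- With the cutoffs absorbed into the function, `heatAverage` is a pure Gaussian average of a
  -- bounded continuous function.
  set w : ℝ → ℝ × ℝ → ℝ := fun s z => u s (framePoint p e z.1 z.2) * (χ z.1 * χ z.2) with hw
  have hwc : ContinuousOn (Function.uncurry w) (Ioo 0 T ×ˢ univ) := by
    refine ContinuousOn.mul ?_ ?_
    · have hF : Continuous fun q : ℝ × ℝ × ℝ => (q.1, framePoint p e q.2.1 q.2.2) :=
        continuous_fst.prodMk ((continuous_framePoint p e).comp continuous_snd)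
      exact hu.comp (g := Function.uncurry u) hF.continuousOn fun q hq => ⟨hq.1, mem_univ _⟩
    · have := hχ.smooth.continuous
      fun_prop
  have hopen : IsOpen (Ioo 0 T ×ˢ (univ : Set (ℝ × ℝ))) := isOpen_Ioo.prod isOpen_univ
  have hρ : 0 ≤ ρ := by linarith [abs_nonneg h]
  have hw0 : w t (0, h) = u t (framePoint p e 0 h) := by
    simp only [hw]
    rw [hχ.eq_one 0 (by rw [abs_zero]; linarith), hχ.eq_one h hh, mul_one, mul_one]
  have hcont : ContinuousAt (Function.uncurry w) (t, (0, h)) :=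
    hwc.continuousAt (hopen.mem_nhds ⟨ht, mem_univ _⟩)
  obtain ⟨d, hd, hdw⟩ := Metric.continuousAt_iff.1 hcont (c / 2) (by positivity)
  have hK : IsCompact (Icc (t / 2) t ×ˢ (Icc (-ρ) ρ ×ˢ Icc (-ρ) ρ)) :=
    isCompact_Icc.prod (isCompact_Icc.prod isCompact_Icc)
  obtain ⟨B, hB⟩ := hK.exists_bound_of_continuousOn (hwc.mono (by
    rintro ⟨s, z⟩ ⟨hs, -⟩
    exact ⟨⟨by linarith [hs.1, ht.1], lt_of_le_of_lt hs.2 ht.2⟩, mem_univ _⟩))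
  have hB0 : 0 ≤ B := (norm_nonneg _).trans (hB (t, (0, 0))
    ⟨⟨by linarith [ht.1], le_rfl⟩, ⟨by linarith, hρ⟩, ⟨by linarith, hρ⟩⟩)
  have hBall : ∀ s ∈ Icc (t / 2) t, ∀ z, |w s z| ≤ B := by
    intro s hs z
    by_cases hz : |z.1| < ρ ∧ |z.2| < ρ
    · exact hB (s, z) ⟨hs, abs_le.1 hz.1.le, abs_le.1 hz.2.le⟩
    · have : w s z = 0 := by
        simp only [hw]
        by_cases h1 : |z.1| < ρ
        · rw [hχ.eq_zero z.2 (not_lt.1 fun h2 => hz ⟨h1, h2⟩), mul_zero, mul_zero]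
        · rw [hχ.eq_zero z.1 (not_lt.1 h1), zero_mul, mul_zero]
      rw [this, abs_zero]
      exact hB0
  -- Chosen so that at distance `d` or more the quadratic term dominates the crude bound on the
  -- oscillation of `w`.
  set A := (B + |w t (0, h)|) / d ^ 2 with hA
  have hA0 : 0 ≤ A := by positivity
  have hpt : ∀ s ∈ Icc (t / 2) t, |s - t| < d → ∀ z : ℝ × ℝ,
      |w s z - w t (0, h)| ≤ c / 2 + A * (z.1 ^ 2 + (z.2 - h) ^ 2) := by
    intro s hs hsd z
    by_cases hz : |z.1| < d ∧ |z.2 - h| < d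
    · have h1 : dist ((s, z) : ℝ × ℝ × ℝ) (t, (0, h)) < d := by
        rw [Prod.dist_eq, Prod.dist_eq]
        simp only [Real.dist_eq, sub_zero]
        exact max_lt hsd (max_lt hz.1 hz.2)
      have h2 := hdw h1
      rw [Real.dist_eq] at h2
      have h3 : 0 ≤ A * (z.1 ^ 2 + (z.2 - h) ^ 2) := by positivity
      have h4 : |w s z - w t (0, h)| < c / 2 := h2
      linarith
    · have h1 : d ^ 2 ≤ z.1 ^ 2 + (z.2 - h) ^ 2 := by
        by_cases h1 : |z.1| < d
        · have h2 : d ≤ |z.2 - h| := not_lt.1 fun h2 => hz ⟨h1, h2⟩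
          have h3 : d ^ 2 ≤ |z.2 - h| ^ 2 := by gcongr
          rw [sq_abs] at h3
          nlinarith [sq_nonneg z.1]
        · have h3 : d ^ 2 ≤ |z.1| ^ 2 := by gcongr; exact not_lt.1 h1
          rw [sq_abs] at h3
          nlinarith [sq_nonneg (z.2 - h)]
      have h2 : B + |w t (0, h)| ≤ A * (z.1 ^ 2 + (z.2 - h) ^ 2) := by
        calc B + |w t (0, h)| = A * d ^ 2 := by rw [hA]; field_simp
          _ ≤ _ := by gcongr
      have h3 := (abs_sub (w s z) (w t (0, h))).trans (add_le_add_left (hBall s hs z) _)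
      linarith
  have hsmall : ∀ᶠ β in 𝓝[>] (0 : ℝ), β < t / 2 ∧ β < d ∧ 8 * A * β < c / 2 := by
    refine (Filter.Eventually.and ?_ (Filter.Eventually.and ?_ ?_)) <;>
      refine eventually_nhdsWithin_of_eventually_nhds ?_
    · exact eventually_lt_nhds (by linarith [ht.1])
    · exact eventually_lt_nhds hd
    · have : Tendsto (fun β : ℝ => 8 * A * β) (𝓝 0) (𝓝 (8 * A * 0)) :=
        (continuous_const.mul continuous_id).tendsto 0
      rw [mul_zero] at this
      exact this.eventually_lt_const (by positivity)
  filter_upwards [hsmall, self_mem_nhdsWithin] with β hβ hβ0 s hs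
  rw [mem_Ioi] at hβ0
  have hτ : 0 < t + β - s := by linarith [hs.2]
  have hs' : s ∈ Icc (t / 2) t := ⟨by linarith [hs.1, hβ.1], hs.2⟩
  have hsd : |s - t| < d := by
    rw [abs_lt]
    exact ⟨by linarith [hs.1, hβ.2.1], by linarith [hs.2]⟩
  have hws : Continuous (w s) := by
    have h1 : ContinuousOn (fun z => Function.uncurry w (s, z)) univ :=
      hwc.comp (by fun_prop) fun z _ => ⟨⟨by linarith [hs'.1, ht.1], lt_of_le_of_lt hs.2 ht.2⟩,
        mem_univ _⟩
    exact continuousOn_univ.1 h1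
  have hmain := abs_integral_mul_heatKernel_sub_le hτ h hws.aestronglyMeasurable (hpt s hs' hsd)
  have heq : heatAverage p e u χ (t + β) h s =
      ∫ z : ℝ × ℝ, w s z * (heatKernel (t + β - s) z.1 * heatKernel (t + β - s) (z.2 - h)) := by
    rw [heatAverage, ← integral_framePoint p e]
    congr 1
    funext z
    rw [frameCoord_framePoint_zero, frameCoord_framePoint_one]
    simp only [hw, cutoffKernel, sub_zero]
    ring
  rw [heq, ← hw0]
  refine hmain.trans ?_
  have h1 : 4 * A * (t + β - s) ≤ 8 * A * β := by
    have : t + β - s ≤ 2 * β := by linarith [hs.1]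
    nlinarith
  linarith [hβ.2.2]

end

/-! ### Testing the weak equation with the backward kernel. -/

lemma measurable_heatKernel_uncurry : Measurable (Function.uncurry heatKernel) := by
  unfold heatKernel Function.uncurry
  fun_prop

lemma measurable_heatKernelDeriv_uncurry : Measurable (Function.uncurry heatKernelDeriv) := by
  have h1 : Measurable fun q : ℝ × ℝ => -(q.2 / (2 * q.1)) := by fun_prop
  exact h1.mul measurable_heatKernel_uncurry

lemma inv_sqrt_le_inv {τ : ℝ} (hτ : 0 < τ) (hτ1 : τ ≤ 1) : (√(4 * Real.pi * τ))⁻¹ ≤ τ⁻¹ := by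
  refine inv_anti₀ hτ (Real.le_sqrt_of_sq_le ?_)
  nlinarith [Real.pi_gt_three]

section

variable (p : Plane) (e : OrthonormalBasis (Fin 2) ℝ Plane) {χ η : ℝ → ℝ} {ρ Q t β M : ℝ}

lemma measurable_cutoffKernel_frame (hχ : IsCutoff χ ρ Q) (b h : ℝ) (i : Fin 2) :
    Measurable fun q : ℝ × Plane => cutoffKernel χ h (b - q.1) (frameCoord p e i q.2) := by
  have hc : Measurable fun q : ℝ × Plane => frameCoord p e i q.2 :=
    (contDiff_frameCoord p e i).continuous.measurable.comp measurable_snd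
  exact (hχ.measurable.comp hc).mul (measurable_heatKernel_uncurry.comp
    ((measurable_const.sub measurable_fst).prodMk (hc.sub measurable_const)))

lemma measurable_cutoffSource_frame (hχ : IsCutoff χ ρ Q) (b h : ℝ) (i : Fin 2) :
    Measurable fun q : ℝ × Plane => cutoffSource χ h (b - q.1) (frameCoord p e i q.2) := by
  have hc : Measurable fun q : ℝ × Plane => frameCoord p e i q.2 :=
    (contDiff_frameCoord p e i).continuous.measurable.comp measurable_snd
  have ha : Measurable fun q : ℝ × Plane => (b - q.1, frameCoord p e i q.2 - h) :=
    (measurable_const.sub measurable_fst).prodMk (hc.sub measurable_const)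
  exact ((hχ.contDiff_deriv_deriv.continuous.measurable.comp hc).mul
    (measurable_heatKernel_uncurry.comp ha)).add
    (((hχ.contDiff_deriv.continuous.measurable.comp hc).const_mul 2).mul
      (measurable_heatKernelDeriv_uncurry.comp ha))

lemma cutoffKernel_eq_zero_of_notMem (hχ : IsCutoff χ ρ Q) {R : ℝ}
    (hR : Metric.closedBall p (2 * ρ) ⊆ Metric.closedBall 0 R) {y : Plane}
    (hy : y ∉ Metric.closedBall (0 : Plane) R) :
    (∀ h τ, cutoffKernel χ h τ (frameCoord p e 0 y) = 0 ∧
      cutoffSource χ h τ (frameCoord p e 0 y) = 0) ∨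
    (∀ h τ, cutoffKernel χ h τ (frameCoord p e 1 y) = 0 ∧
      cutoffSource χ h τ (frameCoord p e 1 y) = 0) := by
  have key : ∀ z : ℝ, ρ < |z| → ∀ h τ, cutoffKernel χ h τ z = 0 ∧ cutoffSource χ h τ z = 0 := by
    intro z hz h τ
    obtain ⟨h1, h2⟩ := hχ.deriv_eq_zero (Or.inr hz)
    rw [cutoffKernel, cutoffSource, hχ.eq_zero z hz.le, h1, h2]
    simp
  by_cases h0 : ρ < |frameCoord p e 0 y|
  · exact Or.inl (key _ h0)
  · refine Or.inr (key _ ?_)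
    by_contra h1
    refine hy (hR ?_)
    have h4 := dist_framePoint_le p e (frameCoord p e 0 y) (frameCoord p e 1 y)
    rw [framePoint_frameCoord] at h4
    rw [Metric.mem_closedBall]
    linarith [not_lt.1 h0, not_lt.1 h1]

/-- Testing the equation with the localized backward heat kernel. -/
lemma IsWeakSolution.abs_initial_add_source_sub_le {T : ℝ} {lam : ℝ → ℝ} {P₀ : Set Plane}
    {u : ℝ → Plane → ℝ} (hu : IsWeakSolution T lam P₀ u) (hχ : IsCutoff χ ρ Q)
    (hη : IsTimeCutoff η t β M) (hM : 0 ≤ M) (hβ : 0 < β) (hβt : β < t) (htT : t < T)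
    (htβ : t + β ≤ 1) {h : ℝ} {C R : ℝ} (hC : 0 ≤ C)
    (hR : Metric.closedBall p (2 * ρ) ⊆ Metric.closedBall 0 R)
    (hsrc : ∀ τ, 0 < τ → τ ≤ 1 → ∀ z, |cutoffSource χ 0 τ z| ≤ C * τ ^ 2 ∧
      |cutoffSource χ h τ z| ≤ C * τ ^ 2)
    {w c : ℝ} (hm : ∀ s ∈ Icc (t - β) t, |heatAverage p e u χ (t + β) h s - w| ≤ c) :
    |(∫ y, u 0 y * backwardKernel p e η χ (t + β) h 0 y) +
      (∫ s in Ioo 0 T, lam s * ∫ y in frontier (phase u s),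
        backwardKernel p e η χ (t + β) h s y ∂(Measure.hausdorffMeasure 1)) - w| ≤
    M * c + 4 * C * t * ∫ q in Ioo 0 T ×ˢ Metric.closedBall (0 : Plane) R, |u q.1 q.2| := by
  set b := t + β with hb
  have htb : t < b := by linarith
  set k₁ : ℝ → Plane → ℝ := fun s y => deriv η s *
    (cutoffKernel χ 0 (b - s) (frameCoord p e 0 y) *
      cutoffKernel χ h (b - s) (frameCoord p e 1 y)) with hk₁
  set k₂ : ℝ → Plane → ℝ := fun s y => η s *
    kernelDefect χ h (b - s) (frameCoord p e 0 y) (frameCoord p e 1 y) with hk₂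
  have hw := hu.weak _ (isTestFunction_backwardKernel p e hχ hη htb htT h)
  simp only [deriv_add_laplacian_backwardKernel p e hχ hη htb] at hw
  have hηd : Measurable (deriv η) := measurable_deriv η
  have m₁ : Measurable (Function.uncurry k₁) :=
    (hηd.comp measurable_fst).mul ((measurable_cutoffKernel_frame p e hχ b 0 0).mul
      (measurable_cutoffKernel_frame p e hχ b h 1))
  have m₂ : Measurable (Function.uncurry k₂) :=
    (hη.smooth.continuous.measurable.comp measurable_fst).mul
      (((measurable_cutoffSource_frame p e hχ b 0 0).mul
        (measurable_cutoffKernel_frame p e hχ b h 1)).add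
      ((measurable_cutoffKernel_frame p e hχ b 0 0).mul
        (measurable_cutoffSource_frame p e hχ b h 1)))
  have z₁ : ∀ s y, y ∉ Metric.closedBall (0 : Plane) R → k₁ s y = 0 := by
    intro s y hy
    rcases cutoffKernel_eq_zero_of_notMem p e hχ hR hy with h1 | h1
    · simp only [hk₁, (h1 _ _).1, zero_mul, mul_zero]
    · simp only [hk₁, (h1 _ _).1, mul_zero]
  have z₂ : ∀ s y, y ∉ Metric.closedBall (0 : Plane) R → k₂ s y = 0 := by
    intro s y hy
    rcases cutoffKernel_eq_zero_of_notMem p e hχ hR hy with h1 | h1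
    · simp only [hk₂, kernelDefect, (h1 _ _).1, (h1 _ _).2, zero_mul, mul_zero, add_zero]
    · simp only [hk₂, kernelDefect, (h1 _ _).1, (h1 _ _).2, mul_zero, add_zero]
  -- This bound blows up as `β → 0`; it serves only for integrability and Fubini.
  have b₁ : ∀ s ∈ Ioo 0 T, ∀ y, |k₁ s y| ≤
      M / β * ((√(4 * Real.pi * β))⁻¹ * (√(4 * Real.pi * β))⁻¹) := by
    intro s hs y
    rcases lt_or_ge t s with hts | hts
    · simp only [hk₁, hη.deriv_eq_zero_of_lt hts, zero_mul, abs_zero]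
      positivity
    · have hτ : 0 < b - s := by linarith
      have hle : (√(4 * Real.pi * (b - s)))⁻¹ ≤ (√(4 * Real.pi * β))⁻¹ := by
        refine inv_anti₀ (by positivity) (Real.sqrt_le_sqrt ?_)
        exact mul_le_mul_of_nonneg_left (by linarith) (by positivity)
      have n0 := cutoffKernel_nonneg hχ 0 (b - s) (frameCoord p e 0 y)
      have n1 := cutoffKernel_nonneg hχ h (b - s) (frameCoord p e 1 y)
      simp only [hk₁]
      rw [abs_mul, abs_of_nonneg (mul_nonneg n0 n1)]
      exact mul_le_mul (hη.abs_deriv_le s hs.1)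
        (mul_le_mul ((cutoffKernel_le hχ 0 _ hτ).trans hle) ((cutoffKernel_le hχ h _ hτ).trans hle)
          n1 (by positivity)) (mul_nonneg n0 n1) (by positivity)
  -- Each half of the defect is at most `C τ² · τ⁻¹` with `τ = b - s ≤ 2t`, uniformly in `β`.
  have b₂ : ∀ s ∈ Ioo 0 T, ∀ y, |k₂ s y| ≤ 4 * C * t := by
    intro s hs y
    rcases lt_or_ge t s with hts | hts
    · simp only [hk₂, hη.eq_zero s hts.le, zero_mul, abs_zero]
      have : 0 < t := by linarith
      positivity
    · have hτ : 0 < b - s := by linarith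
      have hτ1 : b - s ≤ 1 := by linarith [hs.1]
      have hk : ∀ h z, |cutoffKernel χ h (b - s) z| ≤ (b - s)⁻¹ := fun h z => by
        rw [abs_of_nonneg (cutoffKernel_nonneg hχ _ _ _)]
        exact (cutoffKernel_le hχ h z hτ).trans (inv_sqrt_le_inv hτ hτ1)
      have hd : |kernelDefect χ h (b - s) (frameCoord p e 0 y) (frameCoord p e 1 y)| ≤
          C * (b - s) ^ 2 * (b - s)⁻¹ + (b - s)⁻¹ * (C * (b - s) ^ 2) := by
        refine (abs_add_le _ _).trans ?_
        rw [abs_mul, abs_mul]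
        have s0 := (hsrc _ hτ hτ1 (frameCoord p e 0 y)).1
        have s1 := (hsrc _ hτ hτ1 (frameCoord p e 1 y)).2
        have k0 := hk 0 (frameCoord p e 0 y)
        have k1 := hk h (frameCoord p e 1 y)
        gcongr
      simp only [hk₂]
      rw [abs_mul, abs_of_nonneg (hη.nonneg s)]
      refine (mul_le_of_le_one_left (abs_nonneg _) (hη.le_one s)).trans (hd.trans ?_)
      calc C * (b - s) ^ 2 * (b - s)⁻¹ + (b - s)⁻¹ * (C * (b - s) ^ 2) = 2 * C * (b - s) := by
            field_simp
            ring
        _ ≤ 2 * C * (2 * t) := by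
            gcongr
            linarith [hs.1]
        _ = _ := by ring
  obtain ⟨i₁, -⟩ := integrable_mul_of_bounded (hu.integrableOn R) m₁ b₁ z₁
  obtain ⟨i₂, e₂⟩ := integrable_mul_of_bounded (hu.integrableOn R) m₂ b₂ z₂
  have hav : ∀ s, ∫ y, u s y * k₁ s y = deriv η s * heatAverage p e u χ b h s := by
    intro s
    rw [heatAverage, ← integral_const_mul]
    congr 1
    funext y
    simp only [hk₁]
    ring
  have hsplit : (∫ s in Ioo 0 T, ∫ y, u s y * (k₁ s y + k₂ s y)) =
      (∫ s in Ioo 0 T, deriv η s * heatAverage p e u χ b h s) +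
        ∫ s in Ioo 0 T, ∫ y, u s y * k₂ s y := by
    have h1 := integral_prod _ (i₁.add i₂)
    have h2 := integral_prod _ i₁
    have h3 := integral_prod _ i₂
    simp only [Pi.add_apply, ← mul_add] at h1
    rw [← h1]
    simp only [hav] at h2
    simp only [mul_add]
    rw [integral_add i₁ i₂, h2, h3]
  have hI : IntegrableOn (fun s => deriv η s * heatAverage p e u χ b h s) (Ioo 0 T) := by
    have := i₁.integral_prod_left
    simp only [hav] at this
    exact this
  have hA := hη.abs_setIntegral_deriv_mul_add_le hM hβt hβ htT hm hI
  change (∫ s in Ioo 0 T, ∫ y, u s y * (k₁ s y + k₂ s y)) + _ + _ = 0 at hw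
  rw [hsplit] at hw
  have hfin := abs_add_le ((∫ s in Ioo 0 T, deriv η s * heatAverage p e u χ b h s) + w)
    (∫ s in Ioo 0 T, ∫ y, u s y * k₂ s y)
  rw [← abs_neg] at hfin
  refine (le_of_eq ?_).trans (hfin.trans (add_le_add hA e₂))
  congr 1
  linarith

end

/-! ### The initial term and the source term. -/

section

variable (p : Plane) (e : OrthonormalBasis (Fin 2) ℝ Plane) {χ η : ℝ → ℝ} {ρ Q t β M : ℝ}

lemma integral_indicator_mul_backwardKernel (P₀ : Set Plane) {b h : ℝ} (hη : η 0 = 1) :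
    ∫ y, P₀.indicator (fun _ => (1 : ℝ)) y * backwardKernel p e η χ b h 0 y =
      ∫ z : ℝ × ℝ, {z : ℝ × ℝ | framePoint p e z.1 z.2 ∈ P₀}.indicator
        (fun z => χ z.1 * heatKernel b z.1 * (χ z.2 * heatKernel b (z.2 - h))) z := by
  rw [← integral_framePoint p e]
  congr 1
  funext z
  rw [backwardKernel, frameCoord_framePoint_zero, frameCoord_framePoint_one, hη]
  by_cases hz : framePoint p e z.1 z.2 ∈ P₀
  · rw [indicator_of_mem hz, indicator_of_mem (by exact hz)]
    simp [cutoffKernel]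
  · rw [indicator_of_notMem hz, indicator_of_notMem (by exact hz), zero_mul]

/-- Length integral of the localized heat kernel over a nearly flat graph. -/
lemma setIntegral_backwardKernel_graph (hχ : IsCutoff χ ρ Q) {F : Set Plane} (hFm : MeasurableSet F)
    {r ε L h τ : ℝ} (hτ : 0 < τ) (hε : 0 ≤ ε) (hρr : ρ ≤ r) {f : ℝ → ℝ}
    (hF : ∀ x ∈ Ioo (-ρ) ρ, ∀ y ∈ Ioo (-r) r, (framePoint p e x y ∈ F ↔ y = f x))
    (hfρ : ∀ x ∈ Ioo (-ρ) ρ, |f x| ≤ ρ / 2)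
    (hLip : ∀ x ∈ Ioo (-ρ) ρ, ∀ x' ∈ Ioo (-ρ) ρ, |f x - f x'| ≤ ε * |x - x'|)
    (hfh : ∀ x ∈ Ioo (-ρ) ρ, |f x - h| ≤ ε * |x| + L * τ) :
    ∫ y in F, cutoffKernel χ 0 τ (frameCoord p e 0 y) * cutoffKernel χ h τ (frameCoord p e 1 y)
        ∂(Measure.hausdorffMeasure 1) ∈
      Icc ((√(4 * Real.pi * τ))⁻¹ * (1 - ε ^ 2 - L ^ 2 * τ / 2 - 256 * Q * τ ^ 2))
        ((1 + ε) * (√(4 * Real.pi * τ))⁻¹) := by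
  have hfc : ContinuousOn f (Ioo (-ρ) ρ) := by
    refine (LipschitzOnWith.of_dist_le_mul (K := ⟨ε, hε⟩) fun x hx x' hx' => ?_).continuousOn
    exact hLip x hx x' hx'
  have hJ := integral_heatKernel_graph_mem_Icc hχ hτ hfc hfh
  set G : Plane → ℝ := fun y =>
    cutoffKernel χ 0 τ (frameCoord p e 0 y) * cutoffKernel χ h τ (frameCoord p e 1 y) with hG
  have hGc : Continuous G :=
    ((contDiff_cutoffKernel hχ 0 τ).continuous.comp (contDiff_frameCoord p e 0).continuous).mul
      ((contDiff_cutoffKernel hχ h τ).continuous.comp (contDiff_frameCoord p e 1).continuous)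
  have hG0 : ∀ y, 0 ≤ G y := fun y =>
    mul_nonneg (cutoffKernel_nonneg hχ _ _ _) (cutoffKernel_nonneg hχ _ _ _)
  have hGB : ∀ y, G y ≤ (√(4 * Real.pi * τ))⁻¹ * (√(4 * Real.pi * τ))⁻¹ := fun y =>
    mul_le_mul (cutoffKernel_le hχ _ _ hτ) (cutoffKernel_le hχ _ _ hτ)
      (cutoffKernel_nonneg hχ _ _ _) (by positivity)
  have hGs : ∀ y, G y ≠ 0 → |frameCoord p e 0 y| < ρ ∧ |frameCoord p e 1 y| < ρ := by
    intro y hy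
    simp only [hG, cutoffKernel, ne_eq, mul_eq_zero, not_or] at hy
    exact ⟨not_le.1 fun hc => hy.1.1 (hχ.eq_zero _ hc),
      not_le.1 fun hc => hy.2.1 (hχ.eq_zero _ hc)⟩
  have hfr : ∀ x ∈ Ioo (-ρ) ρ, f x ∈ Ioo (-r) r := fun x hx => by
    have h1 := abs_le.1 (hfρ x hx)
    have h2 : 0 < ρ := by linarith [hx.1, hx.2]
    exact ⟨by linarith, by linarith⟩
  have h1 := setIntegral_graph_mem_Icc p e hε hρr hF hfr hLip hGc hG0 hGB hGs hFm
  -- The graph stays at height at most `ρ/2`, where the vertical cutoff is one.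
  have hcong : ∫ x in Ioo (-ρ) ρ, G (framePoint p e x (f x)) =
      ∫ x in Ioo (-ρ) ρ, χ x * heatKernel τ x * heatKernel τ (f x - h) := by
    refine setIntegral_congr_fun measurableSet_Ioo fun x hx => ?_
    simp only [hG, cutoffKernel]
    rw [frameCoord_framePoint_zero, frameCoord_framePoint_one, hχ.eq_one _ (hfρ x hx), sub_zero,
      one_mul]
  rw [hcong] at h1
  exact ⟨hJ.1.trans h1.1, h1.2.trans (mul_le_mul_of_nonneg_left hJ.2 (by linarith))⟩

end

/-- Time integral of a density close to that of the heat kernel on a line. -/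
lemma abs_setIntegral_source_sub_le {η q : ℝ → ℝ} {t β M T l A : ℝ} (hη : IsTimeCutoff η t β M)
    (hβ : 0 < β) (hβt : β < t) (htT : t < T) (hq : IntegrableOn q (Ioo 0 T))
    (hq0 : ∀ s, t ≤ s → q s = 0)
    (hql : ∀ s ∈ Ioo 0 t, |q s - l * (η s * (√(4 * Real.pi * (t + β - s)))⁻¹)| ≤
      A * (√(4 * Real.pi * (t + β - s)))⁻¹) :
    |(∫ s in Ioo 0 T, q s) - l * ((√(t + β) - √β) / √Real.pi)| ≤
      A * ((√(t + β) - √β) / √Real.pi) + |l| * ((√(2 * β) - √β) / √Real.pi) := by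
  set N : ℝ → ℝ := fun s => (√(4 * Real.pi * (t + β - s)))⁻¹ with hN
  obtain ⟨i1, v1⟩ := integral_inv_sqrt (a := 0) (c := t) (b := t + β) (by linarith) (by linarith)
  obtain ⟨i2, v2⟩ := integral_inv_sqrt (a := t - β) (c := t) (b := t + β) (by linarith)
    (by linarith)
  rw [sub_zero, add_sub_cancel_left] at v1
  rw [add_sub_cancel_left, show t + β - (t - β) = 2 * β by ring] at v2
  have hηc := hη.smooth.continuous
  have iη : IntegrableOn (fun s => η s * N s) (Ioo 0 t) :=
    i1.bdd_mul (c := 1) hηc.aestronglyMeasurable (ae_of_all _ fun s => by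
      rw [Real.norm_of_nonneg (hη.nonneg s)]
      exact hη.le_one s)
  have hq' : IntegrableOn q (Ioo 0 t) := hq.mono_set (Ioo_subset_Ioo_right htT.le)
  have e0 : ∫ s in Ioo 0 T, q s = ∫ s in Ioo 0 t, q s := by
    refine setIntegral_eq_of_subset_of_forall_sdiff_eq_zero measurableSet_Ioo
      (Ioo_subset_Ioo_right htT.le) fun s hs => hq0 s ?_
    by_contra hc
    exact hs.2 ⟨hs.1.1, not_le.1 hc⟩
  have e1 : |(∫ s in Ioo 0 t, q s) - l * ∫ s in Ioo 0 t, η s * N s| ≤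
      A * ∫ s in Ioo 0 t, N s := by
    rw [← integral_const_mul, ← integral_const_mul, ← integral_sub hq' (iη.const_mul l),
      ← Real.norm_eq_abs]
    refine norm_integral_le_of_norm_le (i1.const_mul A) ?_
    filter_upwards [ae_restrict_mem measurableSet_Ioo] with s hs
    exact hql s hs
  -- Removing `η` costs only the integral over the last window, which tends to zero with `β`.
  have e2 : |(∫ s in Ioo 0 t, η s * N s) - ∫ s in Ioo 0 t, N s| ≤
      ∫ s in Ioo (t - β) t, N s := by
    rw [← integral_sub iη i1, ← Real.norm_eq_abs]
    have hz : ∀ s ∈ Ioo 0 t \ Ico (t - β) t, η s * N s - N s = 0 := by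
      rintro s ⟨hs, hs'⟩
      rw [hη.eq_one s hs.1.le (not_lt.1 fun hc => hs' ⟨hc.le, hs.2⟩)]
      ring
    rw [setIntegral_eq_of_subset_of_forall_sdiff_eq_zero measurableSet_Ioo
      (s := Ico (t - β) t) (fun s hs => ⟨by linarith [hs.1], hs.2⟩) hz,
      integral_Ico_eq_integral_Ioo]
    refine norm_integral_le_of_norm_le i2 (ae_of_all _ fun s => ?_)
    have h1 : 0 ≤ N s := by positivity
    rw [← sub_one_mul, norm_mul, Real.norm_of_nonneg h1, Real.norm_eq_abs, abs_sub_comm,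
      abs_of_nonneg (sub_nonneg.2 (hη.le_one s))]
    exact mul_le_of_le_one_left h1 (by linarith [hη.nonneg s])
  rw [e0]
  rw [v1] at e1 e2
  rw [v2] at e2
  have e3 := mul_le_mul_of_nonneg_left e2 (abs_nonneg l)
  rw [← abs_mul, mul_sub] at e3
  have := abs_sub_le (∫ s in Ioo 0 t, q s) (l * ∫ s in Ioo 0 t, η s * N s)
    (l * ((√(t + β) - √β) / √Real.pi))
  linarith

/-! ### Taylor expansions and Lipschitz bounds for the moving graph. -/

section Graph

variable {P : ℝ → Set Plane} {δ r : ℝ} {p : Plane} {e : OrthonormalBasis (Fin 2) ℝ Plane}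
  {γ : ℝ → ℝ → ℝ}

lemma IsLocalGraph.contDiffOn_time (hγ : IsLocalGraph P δ r p e γ) (hr : 0 < r) :
    ContDiffOn ℝ ∞ (fun t => γ t 0) (Icc 0 δ) :=
  hγ.smooth.comp (g := Function.uncurry γ) (f := fun t => (t, (0 : ℝ)))
    (contDiff_id.prodMk contDiff_const).contDiffOn fun _ ht => ⟨ht, by simpa using hr⟩

lemma IsLocalGraph.contDiffOn_initial (hγ : IsLocalGraph P δ r p e γ) (hδ : 0 ≤ δ) :
    ContDiffOn ℝ ∞ (γ 0) (Ioo (-r) r) :=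
  hγ.smooth.comp (g := Function.uncurry γ) (f := fun x => ((0 : ℝ), x))
    (contDiff_const.prodMk contDiff_id).contDiffOn fun _ hx => ⟨⟨le_rfl, hδ⟩, hx⟩

/-- First order Taylor expansion in time of the graph at the origin. -/
lemma IsLocalGraph.exists_abs_sub_le (hγ : IsLocalGraph P δ r p e γ) (hδ : 0 ≤ δ) (hr : 0 < r) :
    ∃ c C : ℝ, ∀ t ∈ Icc 0 δ, |γ t 0 - c * t| ≤ C * t ^ 2 := by
  obtain ⟨C, hC⟩ := exists_taylor_mean_remainder_bound (n := 1) hδ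
    ((hγ.contDiffOn_time hr).of_le (by norm_cast))
  refine ⟨derivWithin (fun t => γ t 0) (Icc 0 δ) 0, C, fun t ht => ?_⟩
  have := hC t ht
  rw [taylorWithinEval_succ, taylor_within_zero_eval] at this
  simp only [hγ.origin, sub_zero, Nat.factorial, smul_eq_mul] at this
  norm_num at this
  rwa [mul_comm (derivWithin _ _ _) t]

/-- Second order Taylor expansion in space of the initial graph. -/
lemma IsLocalGraph.eventually_abs_sub_le (hγ : IsLocalGraph P δ r p e γ) (hδ : 0 ≤ δ) (hr : 0 < r)
    {ε : ℝ} (hε : 0 < ε) :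
    ∀ᶠ x in 𝓝 (0 : ℝ), |γ 0 x - iteratedDeriv 2 (γ 0) 0 / 2 * x ^ 2| ≤ ε * x ^ 2 := by
  have h0 : (0 : ℝ) ∈ Ioo (-r) r := by simpa using hr
  have hs := contDiffOn_infty.1 (hγ.contDiffOn_initial hδ) 2
  have h := taylor_isLittleO (n := 2) (convex_Ioo (-r) r) h0 hs
  rw [isOpen_Ioo.nhdsWithin_eq h0] at h
  filter_upwards [h.bound hε] with x hx
  rw [taylorWithinEval_succ, taylorWithinEval_succ, taylor_within_zero_eval,
    iteratedDerivWithin_of_isOpen isOpen_Ioo h0,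
    iteratedDerivWithin_of_isOpen isOpen_Ioo h0] at hx
  norm_num [Nat.factorial, iteratedDeriv_one, hγ.tangent, hγ.origin] at hx
  convert! hx using 2
  ring_nf

/-- The graphs are nearly flat near the origin. -/
lemma IsLocalGraph.exists_lipschitz (hγ : IsLocalGraph P δ r p e γ) (hδ : 0 < δ) (hr : 0 < r)
    {ε : ℝ} (hε : 0 < ε) :
    ∃ d > 0, d ≤ δ ∧ d ≤ r ∧ ∀ s ∈ Icc 0 d, ∀ x ∈ Ioo (-d) d, ∀ x' ∈ Ioo (-d) d,
      |γ s x - γ s x'| ≤ ε * |x - x'| := by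
  set D := Icc 0 δ ×ˢ Ioo (-r) r with hD
  have hDu : UniqueDiffOn ℝ D := (uniqueDiffOn_Icc hδ).prod isOpen_Ioo.uniqueDiffOn
  have hdiff : DifferentiableOn ℝ (Function.uncurry γ) D := hγ.smooth.differentiableOn (by simp)
  have hcont : ContinuousOn (fun q => fderivWithin ℝ (Function.uncurry γ) D q (0, 1)) D :=
    (hγ.smooth.continuousOn_fderivWithin hDu (by simp)).clm_apply continuousOn_const
  have h00 : ((0 : ℝ), (0 : ℝ)) ∈ D := ⟨⟨le_rfl, hδ.le⟩, by simpa using hr⟩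
  have hder : ∀ s ∈ Icc 0 δ, ∀ x ∈ Ioo (-r) r,
      HasDerivAt (γ s) (fderivWithin ℝ (Function.uncurry γ) D (s, x) (0, 1)) x := by
    intro s hs x hx
    have h1 := (hdiff (s, x) ⟨hs, hx⟩).hasFDerivWithinAt
    have h2 : HasDerivWithinAt (fun x : ℝ => (s, x)) (0, 1) (Ioo (-r) r) x :=
      ((hasDerivAt_const x s).prodMk (hasDerivAt_id x)).hasDerivWithinAt
    have h3 := h1.comp_hasDerivWithinAt (f := fun x : ℝ => (s, x)) x h2
      fun y hy => ⟨hs, hy⟩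
    exact h3.hasDerivAt (isOpen_Ioo.mem_nhds hx)
  -- The slope is continuous up to `t = 0` and vanishes at the origin, hence is at most `ε` in a
  -- small space-time box.
  have hz : fderivWithin ℝ (Function.uncurry γ) D (0, 0) (0, 1) = 0 := by
    rw [← (hder 0 ⟨le_rfl, hδ.le⟩ 0 (by simpa using hr)).deriv, hγ.tangent]
  obtain ⟨d, hd, hdD⟩ := Metric.continuousWithinAt_iff.1 (hcont _ h00) ε hε
  refine ⟨min (d / 2) (min δ r), by positivity, (min_le_right _ _).trans (min_le_left _ _),
    (min_le_right _ _).trans (min_le_right _ _), fun s hs x hx x' hx' => ?_⟩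
  have m1 : min (d / 2) (min δ r) ≤ d / 2 := min_le_left _ _
  have m2 : min (d / 2) (min δ r) ≤ δ := (min_le_right _ _).trans (min_le_left _ _)
  have m3 : min (d / 2) (min δ r) ≤ r := (min_le_right _ _).trans (min_le_right _ _)
  set m := min (d / 2) (min δ r)
  have hsδ : s ∈ Icc 0 δ := ⟨hs.1, hs.2.trans m2⟩
  have hsub : ∀ y ∈ Ioo (-m) m, y ∈ Ioo (-r) r := fun y hy => ⟨by linarith [hy.1], by linarith [hy.2]⟩
  refine (convex_Ioo (-m) m).norm_image_sub_le_of_norm_hasDerivWithin_le (C := ε)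
    (fun y hy => (hder s hsδ y (hsub y hy)).hasDerivWithinAt) (fun y hy => ?_) hx' hx
  have h1 : dist ((s, y) : ℝ × ℝ) (0, 0) < d := by
    rw [Prod.dist_eq]
    simp only [Real.dist_eq, sub_zero]
    refine max_lt ?_ ?_
    · rw [abs_of_nonneg hs.1]
      linarith [hs.2]
    · rw [abs_lt]
      exact ⟨by linarith [hy.1], by linarith [hy.2]⟩
  have h2 := hdD (x := (s, y)) ⟨hsδ, hsub y hy⟩ h1
  rw [hz, dist_zero_right] at h2
  exact h2.le

/-- The height of the graph at the origin is Lipschitz in time. -/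
lemma IsLocalGraph.exists_lipschitz_time (hγ : IsLocalGraph P δ r p e γ) (hδ : 0 < δ)
    (hr : 0 < r) :
    ∃ L : ℝ, 0 ≤ L ∧ ∀ s ∈ Icc 0 δ, ∀ s' ∈ Icc 0 δ, |γ s 0 - γ s' 0| ≤ L * |s - s'| := by
  have h := hγ.contDiffOn_time hr
  have hc : ContinuousOn (derivWithin (fun t => γ t 0) (Icc 0 δ)) (Icc 0 δ) :=
    h.continuousOn_derivWithin (uniqueDiffOn_Icc hδ) (by simp)
  obtain ⟨L, hL⟩ := isCompact_Icc.exists_bound_of_continuousOn hc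
  refine ⟨L, (norm_nonneg _).trans (hL 0 ⟨le_rfl, hδ.le⟩), fun s hs s' hs' => ?_⟩
  exact (convex_Icc 0 δ).norm_image_sub_le_of_norm_derivWithin_le
    (h.differentiableOn (by simp)) hL hs' hs

end Graph

/-! ### The balance at the interface and the initial velocity. -/

/-- Passage from the balance of heat contents at time `t` to the velocity. -/
lemma abs_velocity_le_of_balance {k h l t ε A B C : ℝ} (ht : 0 < t)
    (hb : |(√(4 * Real.pi * t))⁻¹ * (k * t - h) + l * (√t / √Real.pi)| ≤
      B * t + (√(4 * Real.pi * t))⁻¹ * (2 * ε * t + C * t ^ 2) + A * (√t / √Real.pi)) :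
    |k - h / t + 2 * l| ≤ 2 * √Real.pi * B * √t + 2 * ε + C * t + 2 * A := by
  have hs : √(4 * Real.pi * t) = 2 * √Real.pi * √t := by
    rw [show 4 * Real.pi * t = 2 ^ 2 * (Real.pi * t) by ring, Real.sqrt_mul (by positivity),
      Real.sqrt_sq (by norm_num), Real.sqrt_mul Real.pi_pos.le]
    ring
  have hp : 0 < √Real.pi := by positivity
  have hx : 0 < √t := by positivity
  rw [hs] at hb
  set x := √t with hxdef
  have htx : t = x ^ 2 := (Real.sq_sqrt ht.le).symm
  set q := √Real.pi
  -- The factor `2√π / √t` turns `(4πt)^(-1/2)` into `1/t` and `√t / √π` into `2`; an error `B t`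
  -- becomes `O(√t)`.
  have hpos : 0 < 2 * q / x := by positivity
  have h1 := mul_le_mul_of_nonneg_left hb hpos.le
  rw [← abs_of_pos hpos, ← abs_mul, abs_of_pos hpos] at h1
  have e1 : 2 * q / x * ((2 * q * x)⁻¹ * (k * t - h) + l * (x / q)) = k - h / t + 2 * l := by
    rw [htx]; field_simp
  have e2 : 2 * q / x * (B * t + (2 * q * x)⁻¹ * (2 * ε * t + C * t ^ 2) + A * (x / q)) =
      2 * q * B * x + 2 * ε + C * t + 2 * A := by
    rw [htx]; field_simp; ring
  rwa [e1, e2] at h1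

section

variable {T : ℝ} {lam : ℝ → ℝ} {P₀ : Set Plane} {u : ℝ → Plane → ℝ} {δ r : ℝ} {p : Plane}
  {e : OrthonormalBasis (Fin 2) ℝ Plane} {γ : ℝ → ℝ → ℝ}

/-- The level `1/2` separates the two values of the indicator. This transfers the local graph
description at time `0` to `P₀`. -/
lemma IsWeakSolution.phase_zero (hu : IsWeakSolution T lam P₀ u) : phase u 0 = P₀ := by
  ext x
  simp only [phase, hu.initial, mem_ofPred_eq, indicator]
  split_ifs with h
  · simp only [h, iff_true]; norm_num
  · simp only [h, iff_false]; norm_num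

/-- The source density of the localized heat kernel at time `s`. -/
lemma abs_source_sub_le {χ η : ℝ → ℝ} {ρ Q t β M ε L : ℝ} (hχ : IsCutoff χ ρ Q)
    (hη : IsTimeCutoff η t β M) (hγ : IsLocalGraph (phase u) δ r p e γ) (hβ : 0 < β)
    (hε : 0 ≤ ε) (hε1 : ε ≤ 1 / 4) (hρr : ρ ≤ r) (htδ : t ≤ δ) (htρ : t ≤ ρ)
    (hL : 0 ≤ L) (hγt : ∀ s ∈ Icc 0 δ, ∀ s' ∈ Icc 0 δ, |γ s 0 - γ s' 0| ≤ L * |s - s'|)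
    (hγx : ∀ s ∈ Icc 0 ρ, ∀ x ∈ Ioo (-ρ) ρ, ∀ x' ∈ Ioo (-ρ) ρ,
      |γ s x - γ s x'| ≤ ε * |x - x'|)
    (hLt : L * t ≤ ρ / 4) (hβt : β ≤ t) (hQ : 0 ≤ Q) (hsmall : L ^ 2 * t + 1024 * Q * t ^ 2 ≤ ε)
    {s : ℝ} (hs : s ∈ Ioo 0 t) (hlam : |lam s - lam 0| ≤ ε) :
    |lam s * (∫ y in frontier (phase u s), backwardKernel p e η χ (t + β) (γ t 0) s y
        ∂(Measure.hausdorffMeasure 1)) - lam 0 * (η s * (√(4 * Real.pi * (t + β - s)))⁻¹)| ≤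
      (2 + 2 * |lam 0|) * ε * (√(4 * Real.pi * (t + β - s)))⁻¹ := by
  have ht : 0 < t := hs.1.trans hs.2
  have hsδ : s ∈ Icc 0 δ := ⟨hs.1.le, hs.2.le.trans htδ⟩
  have hsρ : s ∈ Icc 0 ρ := ⟨hs.1.le, hs.2.le.trans htρ⟩
  have hρ : 0 < ρ := ht.trans_le htρ
  have hτ : 0 < t + β - s := by linarith [hs.2]
  have h00 : (0 : ℝ) ∈ Ioo (-ρ) ρ := by simpa using hρ
  set τ := t + β - s with hτdef
  set N := (√(4 * Real.pi * τ))⁻¹ with hN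
  have hN0 : 0 ≤ N := by positivity
  have hx0 : ∀ x ∈ Ioo (-ρ) ρ, |γ s x - γ s 0| ≤ ε * |x| := fun x hx => by
    simpa using hγx s hsρ x hx 0 h00
  have hfρ : ∀ x ∈ Ioo (-ρ) ρ, |γ s x| ≤ ρ / 2 := by
    intro x hx
    have h1 := hx0 x hx
    have h2 := hγt s hsδ 0 ⟨le_rfl, ht.le.trans htδ⟩
    rw [hγ.origin, sub_zero, sub_zero, abs_of_pos hs.1] at h2
    have h3 : |x| ≤ ρ := (abs_lt.2 hx).le
    have h4 : ε * |x| ≤ 1 / 4 * ρ := mul_le_mul hε1 h3 (abs_nonneg _) (by norm_num)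
    have h5 : L * s ≤ L * t := mul_le_mul_of_nonneg_left hs.2.le hL
    have h6 := abs_add_le (γ s x - γ s 0) (γ s 0)
    rw [sub_add_cancel] at h6
    linarith
  have hfh : ∀ x ∈ Ioo (-ρ) ρ, |γ s x - γ t 0| ≤ ε * |x| + L * τ := by
    intro x hx
    have h2 := hγt s hsδ t ⟨ht.le, htδ⟩
    rw [abs_sub_comm s t, abs_of_pos (sub_pos.2 hs.2)] at h2
    have h5 : L * (t - s) ≤ L * τ := mul_le_mul_of_nonneg_left (by linarith) hL
    linarith [abs_sub_le (γ s x) (γ s 0) (γ t 0), hx0 x hx]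
  have hF : ∀ x ∈ Ioo (-ρ) ρ, ∀ y ∈ Ioo (-r) r,
      (framePoint p e x y ∈ frontier (phase u s) ↔ y = γ s x) := fun x hx y hy =>
    hγ.mem_frontier_iff s hsδ x ⟨by linarith [hx.1], by linarith [hx.2]⟩ y hy
  have hJ := setIntegral_backwardKernel_graph p e hχ isClosed_frontier.measurableSet hτ hε hρr hF
    hfρ (hγx s hsρ) hfh
  simp only [backwardKernel]
  rw [integral_const_mul]
  set J := ∫ y in frontier (phase u s), cutoffKernel χ 0 τ (frameCoord p e 0 y) *
    cutoffKernel χ (γ t 0) τ (frameCoord p e 1 y) ∂(Measure.hausdorffMeasure 1)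
  have hτ2 : τ ≤ 2 * t := by linarith [hs.1]
  -- One `ε` pays for `ε²`, the other, through `hsmall` and `τ ≤ 2t`, for the motion of the graph
  -- and the cutoff.
  have hlo : N * (1 - 2 * ε) ≤ J := by
    refine le_trans (mul_le_mul_of_nonneg_left ?_ hN0) hJ.1
    have h1 : L ^ 2 * τ / 2 ≤ L ^ 2 * t := by nlinarith [sq_nonneg L]
    have h2 : 256 * Q * τ ^ 2 ≤ 1024 * Q * t ^ 2 := by
      have : τ ^ 2 ≤ (2 * t) ^ 2 := pow_le_pow_left₀ hτ.le hτ2 2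
      nlinarith
    nlinarith
  have hJN : |J - N| ≤ 2 * ε * N := by
    rw [abs_le]
    constructor <;> nlinarith [hJ.2, mul_nonneg hε hN0]
  have hJ2 : |J| ≤ 2 * N := by
    rw [abs_of_nonneg (le_trans (mul_nonneg hN0 (by linarith)) hlo)]
    nlinarith [hJ.2]
  have heq : lam s * (η s * J) - lam 0 * (η s * N) =
      η s * ((lam s - lam 0) * J + lam 0 * (J - N)) := by ring
  rw [heq, abs_mul, abs_of_nonneg (hη.nonneg s)]
  refine (mul_le_of_le_one_left (abs_nonneg _) (hη.le_one s)).trans ((abs_add_le _ _).trans ?_)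
  rw [abs_mul, abs_mul]
  calc |lam s - lam 0| * |J| + |lam 0| * |J - N| ≤ ε * (2 * N) + |lam 0| * (2 * ε * N) := by
        gcongr
    _ = _ := by ring

/-- The velocity of the interface, up to an arbitrarily small error. -/
lemma IsWeakSolution.exists_eventually_abs_velocity_le (hlam : ContinuousWithinAt lam (Icc 0 T) 0)
    (hP₀ : MeasurableSet P₀) (hu : IsWeakSolution T lam P₀ u) (hδ : 0 < δ) (hδT : δ < T)
    (hr : 0 < r) (hγ : IsLocalGraph (phase u) δ r p e γ) {ε : ℝ} (hε : 0 < ε) (hε1 : ε ≤ 1 / 4) :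
    ∃ B C : ℝ, ∀ᶠ t in 𝓝[>] (0 : ℝ),
      |iteratedDeriv 2 (γ 0) 0 - γ t 0 / t + 2 * lam 0| ≤
        2 * √Real.pi * B * √t + 2 * ε + C * t + 2 * ((2 + 2 * |lam 0|) * ε) := by
  set k := iteratedDeriv 2 (γ 0) 0 with hk
  obtain ⟨L, hL, hγt⟩ := hγ.exists_lipschitz_time hδ hr
  obtain ⟨d, hd, hdδ, hdr, hγx⟩ := hγ.exists_lipschitz hδ hr hε
  obtain ⟨d', hd', hψ⟩ := Metric.eventually_nhds_iff.1 (hγ.eventually_abs_sub_le hδ.le hr hε)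
  simp only [dist_zero_right, Real.norm_eq_abs] at hψ
  obtain ⟨d'', hd'', hlam'⟩ := Metric.continuousWithinAt_iff.1 hlam ε hε
  set ρ := min d d' with hρdef
  have hρ : 0 < ρ := lt_min hd hd'
  have hρd : ρ ≤ d := min_le_left _ _
  have hρr : ρ ≤ r := hρd.trans hdr
  obtain ⟨χ, hχ⟩ := exists_isCutoff hρ
  set Q := 16 / ρ ^ 4 with hQdef
  have hQ : 0 ≤ Q := by positivity
  obtain ⟨Cs, hCs0, hCs⟩ := exists_abs_cutoffSource_le hχ hρ
  obtain ⟨M, hM, hηex⟩ := exists_isTimeCutoff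
  set R := ‖p‖ + 2 * ρ with hRdef
  have hR : Metric.closedBall p (2 * ρ) ⊆ Metric.closedBall 0 R := by
    refine Metric.closedBall_subset_closedBall' ?_
    rw [dist_zero_right]
    linarith
  set U := ∫ q in Ioo 0 T ×ˢ Metric.closedBall (0 : Plane) R, |u q.1 q.2| with hU
  have hbox : ∀ x, |x| < ρ → x ∈ Ioo (-r) r := fun x hx => by
    have := abs_lt.1 hx
    exact ⟨by linarith, by linarith⟩
  have hph := hu.phase_zero
  have hS : MeasurableSet {z : ℝ × ℝ | framePoint p e z.1 z.2 ∈ P₀} :=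
    (continuous_framePoint p e).measurable hP₀
  obtain ⟨C, hC⟩ := exists_abs_integral_subgraph_sub_le hχ hQ hL (hε1.trans (by norm_num))
    (fun z hz => hψ (lt_of_lt_of_le hz (min_le_right _ _))) hS
    (fun x y hx hy hxy => by
      have := hγ.below x (hbox x hx) y (hbox y hy) hxy
      rwa [hph] at this)
    (fun x y hx hy hxy => by
      have := hγ.above x (hbox x hx) y (hbox y hy) hxy
      rwa [hph] at this)
  -- `M` comes from averaging `u` with tolerance `t`, and `4 * Cs * U` from the defect of the
  -- kernel.
  refine ⟨M + 4 * Cs * U, C, ?_⟩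
  have hsm : ∀ {f : ℝ → ℝ} {c : ℝ}, Continuous f → f 0 < c → ∀ᶠ t in 𝓝[>] (0 : ℝ), f t < c :=
    fun hf hc => (hf.continuousWithinAt (s := Ioi 0) (x := 0)).eventually_lt_const hc
  filter_upwards [self_mem_nhdsWithin, hsm continuous_id (show id 0 < ρ from hρ),
    hsm continuous_id (show id 0 < d'' from hd''),
    hsm (f := fun t => 2 * t) (c := 1) (by fun_prop) (by norm_num),
    hsm (f := fun t => L * t) (c := ρ / 4) (by fun_prop) (by simpa using hρ),
    hsm (f := fun t => L ^ 2 * t + 1024 * Q * t ^ 2) (c := ε) (by fun_prop) (by simpa using hε)]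
    with t ht0 htρ htd ht1 htL hte
  simp only [id, mem_Ioi] at ht0 htρ htd
  have htδ : t ≤ δ := htρ.le.trans (hρd.trans hdδ)
  have htT : t < T := lt_of_le_of_lt htδ hδT
  have hht : |γ t 0| ≤ L * t := by
    have := hγt t ⟨ht0.le, htδ⟩ 0 ⟨le_rfl, hδ.le⟩
    rwa [hγ.origin, sub_zero, sub_zero, abs_of_pos ht0] at this
  have hhalf : u t (framePoint p e 0 (γ t 0)) = 1 / 2 := by
    refine hu.eq_half_of_mem_frontier ⟨ht0, htT⟩ ?_
    rw [hγ.mem_frontier_iff t ⟨ht0.le, htδ⟩ 0 (by simpa using hr) _ (hbox _ (by linarith))]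
  refine abs_velocity_le_of_balance ht0 ?_
  -- The tolerance is `t` itself, negligible against `√t`; `β` may then depend on `t`.
  have havg := eventually_abs_heatAverage_sub_le p e hu.continuousOn hχ ⟨ht0, htT⟩
    (h := γ t 0) (by linarith) ht0
  rw [hhalf] at havg
  set A := (2 + 2 * |lam 0|) * ε with hA
  have hev : ∀ᶠ β in 𝓝[>] (0 : ℝ),
      |(√(4 * Real.pi * (t + β)))⁻¹ * (k * (t + β) - γ t 0) +
        lam 0 * ((√(t + β) - √β) / √Real.pi)| ≤
      (M + 4 * Cs * U) * t +
        (√(4 * Real.pi * (t + β)))⁻¹ * (2 * ε * (t + β) + C * (t + β) ^ 2) +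
        (A * ((√(t + β) - √β) / √Real.pi) + |lam 0| * ((√(2 * β) - √β) / √Real.pi)) := by
    filter_upwards [havg, self_mem_nhdsWithin, hsm continuous_id (show id 0 < t from ht0)]
      with β hβm hβ hβt
    simp only [id, mem_Ioi] at hβ hβt
    obtain ⟨η, hη⟩ := hηex t β hβ hβt
    have h1 := hu.abs_initial_add_source_sub_le p e hχ hη hM hβ hβt htT (by linarith) hCs0 hR
      (h := γ t 0) (fun τ hτ hτ1 z => ⟨hCs τ 0 z hτ hτ1 (by rw [abs_zero]; positivity),
        hCs τ (γ t 0) z hτ hτ1 (by linarith)⟩) hβm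
    rw [hu.initial, integral_indicator_mul_backwardKernel p e P₀
      (hη.eq_one 0 le_rfl (by linarith))] at h1
    have h2 := hC (t + β) (γ t 0) (by linarith) (by linarith)
      (hht.trans (mul_le_mul_of_nonneg_left (by linarith) hL))
    have h3 := abs_setIntegral_source_sub_le (l := lam 0) (A := A) hη hβ hβt htT
      (hu.source_integrable _ (isTestFunction_backwardKernel p e hχ hη
        (b := t + β) (by linarith) htT (γ t 0)))
      (fun s hs => by
        simp only [backwardKernel, hη.eq_zero s hs, zero_mul, integral_zero, mul_zero])
      (fun s hs => abs_source_sub_le hχ hη hγ hβ hε.le hε1 hρr htδ htρ.le hL hγt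
        (fun s hs x hx x' hx' => hγx s ⟨hs.1, hs.2.trans hρd⟩ x
          ⟨by linarith [hx.1], by linarith [hx.2]⟩ x' ⟨by linarith [hx'.1], by linarith [hx'.2]⟩)
        htL.le hβt.le hQ hte.le hs (by
          have h4 := hlam' (x := s) ⟨hs.1.le, by linarith [hs.2]⟩
            (by rw [dist_zero_right, Real.norm_of_nonneg hs.1.le]; linarith [hs.2])
          rw [Real.dist_eq] at h4
          exact h4.le))
    rw [abs_le] at h1 h2 h3 ⊢
    constructor <;> linarith [h1.1, h1.2, h2.1, h2.2, h3.1, h3.2]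
  -- Both sides of `hev` are continuous at `β = 0` because `t > 0`, so `β → 0` gives the balance at
  -- time `t`.
  have hN : ContinuousAt (fun β => (√(4 * Real.pi * (t + β)))⁻¹) 0 := by
    refine ContinuousAt.inv₀ (by fun_prop) ?_
    rw [add_zero]
    positivity
  have lim1 : Tendsto (fun β => |(√(4 * Real.pi * (t + β)))⁻¹ * (k * (t + β) - γ t 0) +
        lam 0 * ((√(t + β) - √β) / √Real.pi)|) (𝓝[>] (0 : ℝ)) (𝓝 _) :=
    (ContinuousAt.abs ((hN.mul (by fun_prop)).add (by fun_prop))).continuousWithinAt.tendsto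
  have lim2 : Tendsto (fun β => (M + 4 * Cs * U) * t +
        (√(4 * Real.pi * (t + β)))⁻¹ * (2 * ε * (t + β) + C * (t + β) ^ 2) +
        (A * ((√(t + β) - √β) / √Real.pi) + |lam 0| * ((√(2 * β) - √β) / √Real.pi)))
      (𝓝[>] (0 : ℝ)) (𝓝 _) :=
    ((continuousAt_const.add (hN.mul (by fun_prop))).add
      (by fun_prop)).continuousWithinAt.tendsto
  have := le_of_tendsto_of_tendsto lim1 lim2 hev
  simpa using this

/-- The initial velocity of the interface. -/
lemma IsWeakSolution.velocity_eq (hlam : ContinuousWithinAt lam (Icc 0 T) 0)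
    (hP₀ : MeasurableSet P₀) (hu : IsWeakSolution T lam P₀ u) (hδ : 0 < δ) (hδT : δ < T)
    (hr : 0 < r) (hγ : IsLocalGraph (phase u) δ r p e γ) {c C : ℝ}
    (hc : ∀ t ∈ Icc 0 δ, |γ t 0 - c * t| ≤ C * t ^ 2) :
    c = iteratedDeriv 2 (γ 0) 0 + 2 * lam 0 := by
  set k := iteratedDeriv 2 (γ 0) 0 with hk
  have hlim : Tendsto (fun t => γ t 0 / t) (𝓝[>] (0 : ℝ)) (𝓝 c) := by
    refine tendsto_iff_norm_sub_tendsto_zero.2 (squeeze_zero' (g := fun t => C * t)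
      (Eventually.of_forall fun _ => norm_nonneg _) ?_ ?_)
    · filter_upwards [Ioc_mem_nhdsGT hδ] with t ht
      have h1 := hc t ⟨ht.1.le, ht.2⟩
      rw [Real.norm_eq_abs, div_sub' ht.1.ne', abs_div, abs_of_pos ht.1, div_le_iff₀ ht.1,
        mul_comm t c]
      linarith
    · have : Tendsto (fun t : ℝ => C * t) (𝓝 0) (𝓝 (C * 0)) :=
        (continuous_const.mul continuous_id).tendsto 0
      rw [mul_zero] at this
      exact this.mono_left nhdsWithin_le_nhds
  -- As `t → 0` only the multiples of `ε` survive, `2ε + 2(2 + 2|lam 0|)ε`; the left side does not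
  -- depend on `ε`.
  have key : ∀ ε : ℝ, 0 < ε → ε ≤ 1 / 4 →
      |k - c + 2 * lam 0| ≤ (6 + 4 * |lam 0|) * ε := by
    intro ε hε hε1
    obtain ⟨B, C', hB⟩ := hu.exists_eventually_abs_velocity_le hlam hP₀ hδ hδT hr hγ hε hε1
    have l1 : Tendsto (fun t => |k - γ t 0 / t + 2 * lam 0|) (𝓝[>] (0 : ℝ))
        (𝓝 |k - c + 2 * lam 0|) := ((hlim.const_sub k).add_const _).abs
    have l2 : Tendsto (fun t => 2 * √Real.pi * B * √t + 2 * ε + C' * t +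
        2 * ((2 + 2 * |lam 0|) * ε)) (𝓝[>] (0 : ℝ)) (𝓝 _) :=
      (ContinuousAt.continuousWithinAt (x := 0) (by fun_prop)).tendsto
    have := le_of_tendsto_of_tendsto l1 l2 hB
    simp only [Real.sqrt_zero, mul_zero, zero_add, add_zero] at this
    linarith
  by_contra hne
  have hpos : 0 < |k - c + 2 * lam 0| := abs_pos.2 fun h => hne (by linarith)
  have hD : 0 < 6 + 4 * |lam 0| := by positivity
  set a := |k - c + 2 * lam 0| with ha
  have h1 := key (min (1 / 4) (a / (2 * (6 + 4 * |lam 0|)))) (by positivity) (min_le_left _ _)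
  have h2 : (6 + 4 * |lam 0|) * min (1 / 4) (a / (2 * (6 + 4 * |lam 0|))) ≤ a / 2 := by
    calc _ ≤ (6 + 4 * |lam 0|) * (a / (2 * (6 + 4 * |lam 0|))) :=
          mul_le_mul_of_nonneg_left (min_le_right _ _) hD.le
      _ = _ := by field_simp
  linarith

end

theorem mainTheorem2
    (T : ℝ) (lam : ℝ → ℝ) (hlam : ContDiffOn ℝ ∞ lam (Icc 0 T))
    (P₀ : Set Plane) (hP₀ : MeasurableSet P₀)
    (u : ℝ → Plane → ℝ) (hu : IsWeakSolution T lam P₀ u)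
    (δ r : ℝ) (hδ : 0 < δ) (hδT : δ < T) (hr : 0 < r)
    (p : Plane) (e : OrthonormalBasis (Fin 2) ℝ Plane) (γ : ℝ → ℝ → ℝ)
    (hγ : IsLocalGraph (phase u) δ r p e γ) :
    (∀ᶠ t in 𝓝[>] (0 : ℝ), ∃! w : ℝ,
        t * w ∈ Ioo (-r) r ∧ p + (t * w) • e 1 ∈ frontier (phase u t)) ∧
    ∀ v : ℝ → ℝ,
      (∀ᶠ t in 𝓝[>] (0 : ℝ),
        t * v t ∈ Ioo (-r) r ∧ p + (t * v t) • e 1 ∈ frontier (phase u t)) →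
      (∀ᶠ t in 𝓝[>] (0 : ℝ), u t (p + (t * v t) • e 1) = 1 / 2) ∧
      (fun t => v t - (-subgraphCurvature (γ 0) 0 + 2 * lam 0)) =O[𝓝[>] (0 : ℝ)]
        (fun t => t) := by
  have hiff : ∀ t ∈ Icc 0 δ, ∀ x ∈ Ioo (-r) r,
      (p + x • e 1 ∈ frontier (phase u t) ↔ x = γ t 0) := fun t ht x hx => by
    have := hγ.mem_frontier_iff t ht 0 (by simpa using hr) x hx
    simpa [framePoint] using this
  have hsmall : ∀ᶠ t in 𝓝[>] (0 : ℝ), t ∈ Ioc 0 δ := Ioc_mem_nhdsGT hδ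
  obtain ⟨c, C, hc⟩ := hγ.exists_abs_sub_le hδ.le hr
  constructor
  · obtain ⟨L, hL, hγt⟩ := hγ.exists_lipschitz_time hδ hr
    have hL' : ∀ᶠ t in 𝓝[>] (0 : ℝ), L * t < r := by
      have : Continuous fun t : ℝ => L * t := by fun_prop
      exact (this.continuousWithinAt (s := Ioi 0) (x := 0)).eventually_lt_const (by simpa using hr)
    filter_upwards [hsmall, hL'] with t ht htr
    have ht' : t ∈ Icc 0 δ := ⟨ht.1.le, ht.2⟩
    have hin : γ t 0 ∈ Ioo (-r) r := by
      have := hγt t ht' 0 ⟨le_rfl, hδ.le⟩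
      rw [hγ.origin, sub_zero, sub_zero, abs_of_pos ht.1] at this
      exact abs_lt.1 (this.trans_lt htr)
    have hmul : t * (γ t 0 / t) = γ t 0 := mul_div_cancel₀ _ ht.1.ne'
    refine ⟨γ t 0 / t, ?_, fun w hw => ?_⟩
    · simp only
      rw [hmul]
      exact ⟨hin, (hiff t ht' _ hin).2 rfl⟩
    · rw [eq_div_iff ht.1.ne', mul_comm]
      exact (hiff t ht' _ hw.1).1 hw.2
  · intro v hv
    constructor
    · filter_upwards [hsmall, hv] with t ht htv
      exact hu.eq_half_of_mem_frontier ⟨ht.1, lt_of_le_of_lt ht.2 hδT⟩ htv.2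
    -- The heat balance identifies the Taylor coefficient `c`; the horizontal tangent makes the
    -- curvature denominator one. The rate `O(t)` then comes from `hc` with `t * v t = γ t 0`.
    · have hcurv : -subgraphCurvature (γ 0) 0 + 2 * lam 0 = c := by
        rw [hu.velocity_eq (hlam.continuousOn 0 ⟨le_rfl, by linarith⟩) hP₀ hδ hδT hr hγ hc,
          subgraphCurvature, hγ.tangent]
        simp
      rw [hcurv]
      refine IsBigO.of_bound C ?_
      filter_upwards [hsmall, hv] with t ht htv
      have ht' : t ∈ Icc 0 δ := ⟨ht.1.le, ht.2⟩
      have h1 := hc t ht'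
      rw [← (hiff t ht' _ htv.1).1 htv.2, mul_comm c t, ← mul_sub, abs_mul, abs_of_pos ht.1] at h1
      rw [Real.norm_eq_abs, Real.norm_eq_abs, abs_of_pos ht.1]
      exact le_of_mul_le_mul_left (h1.trans (le_of_eq (by ring))) ht.1
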